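/- Let $n\ge 2$ and let $\xi_1,\dots,\xi_n$ be vectors of equal length in the open upper half-plane $\mathbb R\times\mathbb R_{>0}$, going in this order strictly clockwise around the origin. Let $Z=\{\sum_i a_i\xi_i : 0\le a_i\le 1\}$ be the zonogon they generate. For $i<j$, an $ij$-tile is a translate of the rhombus $[0,\xi_i]+[0,\xi_j]$. A rhombus tiling $T$ of $Z$ is a finite set of tiles whose union is $Z$ and such that any two different tiles that intersect have exactly one common vertex or exactly one common closed edge as their intersection. Direct all edges of the tiles upward, so that each edge goes from some point $p$ to $p+\xi_i$ for some $i$, called its colour. A snake of $T$ is a maximal directed path in the resulting graph of vertices and edges of $T$. Let $\Sigma(T)$ be the set of linear orders $x_1<x_2<\dots<x_n$ on $[n]=\{1,\dots,n\}$ such that $x_1,x_2,\dots,x_n$ is the sequence of edge colours along some snake of $T$; the sets of the form $\Sigma(T)$ are called tiling Condorcet domains. A set $\mathcal D$ of linear orders on $[n]$ is called a peak-pit domain if for each triple $i<j<k$ in $[n]$ the restrictions of the members of $\mathcal D$ to $\{i,j,k\}$ all lie in $\{ijk,\,ikj,\,kij,\,kji\}$ (that is, $j$ is never the least of the three), or all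 lie in $\{ijk,\,jik,\,jki,\,kji\}$ (that is, $j$ is never the greatest of the three). **Theorem.** For every peak-pit domain $\mathcal D$ of linear orders on $[n]$ there is a rhombus tiling $T$ of $Z$ such that $\mathcal D\subseteq\Sigma(T)$; that is, any peak-pit domain is contained in a tiling Condorcet domain. -/

import Mathlib

namespace Condorcet

/-! ## Linear orders on the alternatives and peak-pit domains -/

/-- A linear order `x₁ < x₂ < … < xₙ` on the `n` alternatives, encoded by the word `x₁ x₂ … xₙ`:
the permutation `σ` sends a position to the alternative in that position
(position `0` is the least, i.e. worst, alternative). -/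
abbrev LinOrd (n : ℕ) : Type := Equiv.Perm (Fin n)

/-- The word `x₁ x₂ … xₙ` of a linear order. -/
def word {n : ℕ} (σ : LinOrd n) : List (Fin n) := List.ofFn σ

/-- `a <_σ b`: the alternative `a` stands before `b` in the word of `σ`. -/
def Before {n : ℕ} (σ : LinOrd n) (a b : Fin n) : Prop := σ.symm a < σ.symm b

/-- The restriction of `σ` to the three alternatives `a, b, c` is the word `abc`. -/
def RestrictsTo {n : ℕ} (σ : LinOrd n) (a b c : Fin n) : Prop := Before σ a b ∧ Before σ b c

/-- The restriction of `σ` to `i < j < k` lies in the peak domain `{ijk, ikj, kij, kji}`. -/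
def InPeak {n : ℕ} (σ : LinOrd n) (i j k : Fin n) : Prop :=
  RestrictsTo σ i j k ∨ RestrictsTo σ i k j ∨ RestrictsTo σ k i j ∨ RestrictsTo σ k j i

/-- The restriction of `σ` to `i < j < k` lies in the pit domain `{ijk, jik, jki, kji}`. -/
def InPit {n : ℕ} (σ : LinOrd n) (i j k : Fin n) : Prop :=
  RestrictsTo σ i j k ∨ RestrictsTo σ j i k ∨ RestrictsTo σ j k i ∨ RestrictsTo σ k j i

/-- For each triple `i < j < k`, the projection of `D` to `{i, j, k}` is contained in the peak
domain or in the pit domain of that triple. -/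
def IsPeakPit {n : ℕ} (D : Set (LinOrd n)) : Prop :=
  ∀ i j k : Fin n, i < j → j < k → (∀ σ ∈ D, InPeak σ i j k) ∨ (∀ σ ∈ D, InPit σ i j k)

/-! ## Zonogons and rhombus tilings -/

/-- The Euclidean plane; `v 0` is the horizontal and `v 1` the vertical coordinate. -/
abbrev Plane : Type := EuclideanSpace ℝ (Fin 2)

/-- Vectors `ξ₁, …, ξₙ` of the same length in the open upper half-plane, going in this order
(strictly) clockwise around the origin. -/
structure IsFan {n : ℕ} (ξ : Fin n → Plane) : Prop where
  upper : ∀ i, 0 < ξ i 1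
  same_length : ∀ i j, ‖ξ i‖ = ‖ξ j‖
  clockwise : ∀ i j, i < j → ξ i 0 * ξ j 1 - ξ i 1 * ξ j 0 < 0

/-- The zonogon: all points `∑ aᵢ ξᵢ` with `0 ≤ aᵢ ≤ 1`. -/
def zonogon {n : ℕ} (ξ : Fin n → Plane) : Set Plane :=
  {p | ∃ a : Fin n → ℝ, (∀ i, 0 ≤ a i ∧ a i ≤ 1) ∧ p = ∑ i, a i • ξ i}

/-- A coloured edge with colour `i`, going from the point `tail` to `tail + ξᵢ`. -/
@[ext] structure Edge (n : ℕ) where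
  tail : Plane
  color : Fin n

/-- The end point of an edge. -/
def Edge.head {n : ℕ} (ξ : Fin n → Plane) (e : Edge n) : Plane := e.tail + ξ e.color

/-- The closed segment occupied by an edge. -/
def Edge.carrier {n : ℕ} (ξ : Fin n → Plane) (e : Edge n) : Set Plane :=
  segment ℝ e.tail (e.head ξ)

/-- The data of an `ij`-tile, `i < j`: its lowest vertex and its two colours. -/
@[ext] structure Tile (n : ℕ) where
  base : Plane
  i : Fin n
  j : Fin n
  lt : i < j

/-- The closed rhombus occupied by a tile: a translate of `[0, ξᵢ] + [0, ξⱼ]`. -/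
def Tile.carrier {n : ℕ} (ξ : Fin n → Plane) (t : Tile n) : Set Plane :=
  {p | ∃ a b : ℝ, (0 ≤ a ∧ a ≤ 1) ∧ (0 ≤ b ∧ b ≤ 1) ∧ p = t.base + a • ξ t.i + b • ξ t.j}

/-- The four vertices of a tile. -/
def Tile.vertices {n : ℕ} (ξ : Fin n → Plane) (t : Tile n) : Set Plane :=
  {t.base, t.base + ξ t.i, t.base + ξ t.j, t.base + ξ t.i + ξ t.j}

/-- The four edges of a tile, directed upward. -/
def Tile.edges {n : ℕ} (ξ : Fin n → Plane) (t : Tile n) : Set (Edge n) :=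
  {⟨t.base, t.i⟩, ⟨t.base, t.j⟩, ⟨t.base + ξ t.j, t.i⟩, ⟨t.base + ξ t.i, t.j⟩}

/-- A rhombus tiling of the zonogon: a finite set of tiles that covers exactly the zonogon, such
that two different tiles that intersect have in common exactly one vertex, or exactly one closed
edge. -/
structure IsRhombusTiling {n : ℕ} (ξ : Fin n → Plane) (T : Finset (Tile n)) : Prop where
  cover : (⋃ t ∈ T, t.carrier ξ) = zonogon ξ
  meet : ∀ s ∈ T, ∀ t ∈ T, s ≠ t → (s.carrier ξ ∩ t.carrier ξ).Nonempty →
    (∃ v, v ∈ s.vertices ξ ∧ v ∈ t.vertices ξ ∧ s.carrier ξ ∩ t.carrier ξ = {v}) ∨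
    (∃ e, e ∈ s.edges ξ ∧ e ∈ t.edges ξ ∧ s.carrier ξ ∩ t.carrier ξ = e.carrier ξ)

/-! ## Snakes and the domain of a tiling -/

/-- The edges of the directed graph of a tiling: those occurring in its tiles. -/
def edgeSet {n : ℕ} (ξ : Fin n → Plane) (T : Finset (Tile n)) : Set (Edge n) :=
  {e | ∃ t ∈ T, e ∈ t.edges ξ}

/-- A directed path in the graph of a tiling, as the list of its consecutive edges. -/
def IsDirectedPath {n : ℕ} (ξ : Fin n → Plane) (T : Finset (Tile n)) (S : List (Edge n)) : Prop :=
  (∀ e ∈ S, e ∈ edgeSet ξ T) ∧ S.IsChain (fun e f => e.head ξ = f.tail)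

/-- A snake: a directed path that is not a proper part of another directed path. -/
def IsSnake {n : ℕ} (ξ : Fin n → Plane) (T : Finset (Tile n)) (S : List (Edge n)) : Prop :=
  IsDirectedPath ξ T S ∧ ∀ S', IsDirectedPath ξ T S' → S <:+: S' → S' = S

/-- The domain `Σ(T)` of a tiling: the linear orders compatible with `T`, i.e. those whose word is
the sequence of edge colours along some snake of `T`. -/
def tilingDomain {n : ℕ} (ξ : Fin n → Plane) (T : Finset (Tile n)) : Set (LinOrd n) :=
  {σ | ∃ S, IsSnake ξ T S ∧ S.map Edge.color = word σ}

end Condorcet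

/-! Let S consist of all initial segments of the orders in the domain. Two members of S that are not
strongly separated would yield i < j < k with j after i and k in one order but before both in
another. The first excludes the pit alternative and the second the peak alternative
(`IsPeakPit.stronglySeparated`).

The left boundary of the zonogon reads 1, …, n upward and the right boundary n, …, 1. Replacing
consecutive colours i < j by j, i moves a path to the right across one rhombus, and a run of such
exchanges from one boundary to the other sweeps out a tiling. The exchanges have to be chosen so
that the path's initial segments stay strongly separated from S. An exchange of this kind always
exists: a colex-minimal member of S among those that call for an exchange names one that no member
of S forbids (`exists_unblocked_ascent`).

Every Y in S starts to the right of the path, and it can be passed only by the exchange that leaves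
the vertex Y itself (`Ahead.flip`). So for consecutive initial segments X and X ∪ {c} of an order in
the domain, the first exchange that passes one of them has the edge between them on its tile. If
neither is ever passed, the edge lies on the right boundary (`exists_sweep`). All edges of the
order's path are thus edges of the tiling, and the path is a snake.

For the geometry, a path is the graph of a function of height and a tile is the region between the
graphs before and after its exchange. Later tiles lie weakly to the right of the new path, so they
meet the tile only along its two right edges (`Sweep.meetProperly_head`). -/

namespace Condorcet

variable {n : ℕ} {ξ : Fin n → Plane}

/-! ## Strong separation -/

/-- `X` lies weakly to the left of `Y`: every element of `X \ Y` is below every element of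
`Y \ X`. -/
def Precedes (X Y : Finset (Fin n)) : Prop :=
  ∀ a ∈ X, a ∉ Y → ∀ b ∈ Y, b ∉ X → a < b

/-- Strong separation of sets in the sense of Leclerc and Zelevinsky. -/
def StronglySeparated (X Y : Finset (Fin n)) : Prop := Precedes X Y ∨ Precedes Y X

/-- Some ascent `u < v` at consecutive places of `l` has `u ∉ Y` and `v ∈ Y`. -/
def Wants (l : List (Fin n)) (Y : Finset (Fin n)) : Prop :=
  ∃ A B u v, l = A ++ u :: v :: B ∧ u < v ∧ u ∉ Y ∧ v ∈ Y

/-- All initial segments of `l` are strongly separated from `Y`. -/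
def SeparatedFrom (l : List (Fin n)) (Y : Finset (Fin n)) : Prop :=
  ∀ A B, l = A ++ B → StronglySeparated A.toFinset Y

/-- All initial segments of `l` lie weakly to the left of `Y`. -/
def Ahead (l : List (Fin n)) (Y : Finset (Fin n)) : Prop :=
  ∀ A B, l = A ++ B → Precedes A.toFinset Y

/-! ### Choosing an ascent to exchange -/

theorem StronglySeparated.precedes {X Y : Finset (Fin n)} (h : StronglySeparated X Y)
    {a b : Fin n} (ha : a ∈ X) (ha' : a ∉ Y) (hb : b ∈ Y) (hb' : b ∉ X) (hab : a < b) :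
    Precedes X Y :=
  h.resolve_right fun h' => absurd (h' b hb hb' a ha ha') hab.not_gt

/-- The pair `a`, `b` orients the separation of every initial segment containing `a` but not `b`, so
a letter outside `Y` there is below each element of `Y` yet to come. Walking from `a` towards `b`,
the first step into `Y` is therefore an ascent. -/
theorem wants_of_pair {Y : Finset (Fin n)} {b : Fin n} (hb : b ∈ Y) (Q : List (Fin n)) :
    ∀ (P : List (Fin n)) (a : Fin n), (P ++ a :: Q).Nodup → SeparatedFrom (P ++ a :: Q) Y →
      a ∉ Y → b ∈ Q → a < b → Wants (P ++ a :: Q) Y := by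
  induction Q with
  | nil => intro P a _ _ _ h; simp at h
  | cons q Q ih =>
    intro P a hnd hsep ha hbQ hab
    have hnd' := hnd
    simp only [List.nodup_append, List.nodup_cons, List.mem_cons] at hnd'
    by_cases hq : q ∈ Y
    · have h1 : StronglySeparated (P ++ [a]).toFinset Y := hsep (P ++ [a]) (q :: Q) (by simp)
      have hbn : b ∉ (P ++ [a]).toFinset := by
        simp only [List.mem_toFinset, List.mem_append, List.mem_singleton]; grind
      have h2 := h1.precedes (a := a) (b := b) (by simp) ha hb hbn hab
      refine ⟨P, Q, a, q, rfl, h2 a (by simp) ha q hq ?_, ha, hq⟩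
      simp only [List.mem_toFinset, List.mem_append, List.mem_singleton]; grind
    · have hbQ' : b ∈ Q := by
        rcases List.mem_cons.1 hbQ with rfl | h
        · exact absurd hb hq
        · exact h
      have h1 : StronglySeparated (P ++ [a, q]).toFinset Y := hsep (P ++ [a, q]) Q (by simp)
      have hbn : b ∉ (P ++ [a, q]).toFinset := by
        simp only [List.mem_toFinset, List.mem_append, List.mem_cons, List.not_mem_nil]; grind
      have h2 := h1.precedes (a := a) (b := b) (by simp) ha hb hbn hab
      have h3 : q < b := h2 q (by simp) hq b hb hbn
      have := ih (P ++ [a]) q (by simpa using hnd) (by simpa using hsep) hq hbQ' h3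
      simpa using this

/-- Only the middle initial segment changes, from A ∪ {i} to A ∪ {j}. A set that tolerates the old
one but not the new one must contain `i` and omit `j`, and the failed separation then supplies a
pair for `wants_of_pair`. -/
theorem wants_of_blocked {Y : Finset (Fin n)} {A B : List (Fin n)} {i j : Fin n}
    (hnd : (A ++ i :: j :: B).Nodup) (hall : ∀ x, x ∈ A ++ i :: j :: B)
    (hsep : SeparatedFrom (A ++ i :: j :: B) Y) (hij : i < j)
    (hbl : ¬ StronglySeparated (A ++ [j]).toFinset Y) :
    i ∈ Y ∧ j ∉ Y ∧ Wants (A ++ i :: j :: B) Y := by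
  have h0 : StronglySeparated A.toFinset Y := hsep A _ rfl
  have h1 : StronglySeparated (A ++ [i]).toFinset Y := hsep (A ++ [i]) (j :: B) (by simp)
  have h2 : StronglySeparated (A ++ [i, j]).toFinset Y := hsep (A ++ [i, j]) B (by simp)
  have hnd' := hnd
  simp only [List.nodup_append, List.nodup_cons, List.mem_cons] at hnd'
  have hiA : i ∉ A := by grind
  have hjA : j ∉ A := by grind
  simp only [StronglySeparated, Precedes, List.mem_toFinset, List.mem_append, List.mem_cons,
    List.not_mem_nil, or_false] at h0 h1 h2 hbl
  have hi : i ∈ Y := by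
    by_contra hi
    by_cases hj : j ∈ Y <;> grind
  have hj : j ∉ Y := by
    intro hj
    grind
  refine ⟨hi, hj, ?_⟩
  push Not at hbl
  obtain ⟨-, y, hy, hyn, z, hz, hzY, hzy⟩ := hbl
  have hzlt : z < y := lt_of_le_of_ne hzy (by rintro rfl; exact hzY hy)
  -- The offending z < y has z in A ∪ {j}. If z is in A, the pair fed to `wants_of_pair` is z, i; if
  -- z = j, it is j, y with y in B.
  rcases hz with hz | rfl
  · have hzi : z < i := by
      rcases h0 with h0 | h0
      · exact h0 z hz hzY i hi hiA
      · exact absurd (h0 y hy (by tauto) z hz hzY) hzlt.not_gt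
    obtain ⟨A1, A2, rfl⟩ := List.append_of_mem hz
    have := wants_of_pair hi (A2 ++ i :: j :: B) A1 z (by simpa using hnd) (by simpa using hsep)
      hzY (by simp) hzi
    simpa using this
  · have hyB : y ∈ B := by
      have := hall y
      simp only [List.mem_append, List.mem_cons] at this
      grind
    have := wants_of_pair hy B (A ++ [i]) z (by simpa using hnd) (by simpa using hsep)
      hzY hyB hzlt
    simpa using this

theorem exists_ascent (l : List (Fin n)) (hnd : l.Nodup) (h : ¬ l.Pairwise (· > ·)) :
    ∃ A B u v, l = A ++ u :: v :: B ∧ u < v := by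
  rw [← List.isChain_iff_pairwise] at h
  induction l with
  | nil => simp at h
  | cons a l ih =>
    cases l with
    | nil => simp at h
    | cons b l =>
      by_cases hab : a < b
      · exact ⟨[], l, a, b, rfl, hab⟩
      · have hne : a ≠ b := by rintro rfl; simp at hnd
        have hba : a > b := lt_of_le_of_ne (not_lt.1 hab) hne.symm
        rw [List.isChain_cons_cons] at h
        obtain ⟨A, B, u, v, he, huv⟩ := ih (List.nodup_cons.1 hnd).2 fun h' => h ⟨hba, h'⟩
        exact ⟨a :: A, B, u, v, by simp [he], huv⟩

/-- Take Y colex-minimal among the sets that want an ascent, and let u < v be an ascent it wants. A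
blocker Y' contains u but not v and also wants an ascent. Since u and v orient the separation, Y'
precedes Y, so v dominates Y' \ Y and Y' is colex-below Y, contrary to minimality. If no set wants
anything, no ascent is blocked. -/
theorem exists_unblocked_ascent (S : Set (Finset (Fin n)))
    (hS : ∀ X ∈ S, ∀ Y ∈ S, StronglySeparated X Y) (l : List (Fin n)) (hnd : l.Nodup)
    (hall : ∀ x, x ∈ l) (hsep : ∀ Y ∈ S, SeparatedFrom l Y) (hl : ¬ l.Pairwise (· > ·)) :
    ∃ A B i j, l = A ++ i :: j :: B ∧ i < j ∧
      ∀ Y ∈ S, StronglySeparated (A ++ [j]).toFinset Y := by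
  classical
  let W : Finset (Finset (Fin n)) := Finset.univ.filter fun Y => Y ∈ S ∧ Wants l Y
  by_cases hW : W.Nonempty
  · obtain ⟨Y, hY, hmin⟩ := W.exists_min_image toColex hW
    simp only [W, Finset.mem_filter, Finset.mem_univ, true_and] at hY hmin
    obtain ⟨hYS, A, B, u, v, rfl, huv, hu, hv⟩ := hY
    refine ⟨A, B, u, v, rfl, huv, fun Y' hY' => ?_⟩
    by_contra hbl
    obtain ⟨hu', hv', hw⟩ := wants_of_blocked hnd hall (hsep Y' hY') huv hbl
    have hp : Precedes Y' Y := (hS Y' hY' Y hYS).precedes hu' hu hv hv' huv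
    have hle := hmin Y' ⟨hY', hw⟩
    have hge : toColex Y' ≤ toColex Y := by
      rw [Finset.Colex.toColex_le_toColex]
      intro a ha ha'
      exact ⟨v, hv, hv', (hp a ha ha' v hv hv').le⟩
    have : Y = Y' := toColex_inj.1 (le_antisymm hle hge)
    exact hu (this ▸ hu')
  · obtain ⟨A, B, u, v, rfl, huv⟩ := exists_ascent l hnd hl
    refine ⟨A, B, u, v, rfl, huv, fun Y hY => ?_⟩
    by_contra hbl
    exact hW ⟨Y, by simpa [W] using ⟨hY, (wants_of_blocked hnd hall (hsep Y hY) huv hbl).2.2⟩⟩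

/-! ### Initial segments across an exchange -/

theorem append_cons_cons_eq_append {A B P Q : List (Fin n)} {i j : Fin n}
    (h : A ++ i :: j :: B = P ++ Q) :
    (∃ A', A = P ++ A') ∨ P = A ++ [i] ∨ ∃ B', P = A ++ i :: j :: B' ∧ B = B' ++ Q := by
  rcases List.append_eq_append_iff.1 h with ⟨a, rfl, h2⟩ | ⟨c, rfl, h2⟩
  · rcases a with _ | ⟨x, _ | ⟨y, a⟩⟩
    · left; exact ⟨[], by simp⟩
    · simp at h2; right; left; simp [h2.1]
    · simp at h2; right; right; exact ⟨a, by simp [h2.1, h2.2.1], h2.2.2⟩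
  · left; exact ⟨c, rfl⟩

theorem SeparatedFrom.flip {Y : Finset (Fin n)} {A B : List (Fin n)} {i j : Fin n}
    (h : SeparatedFrom (A ++ i :: j :: B) Y) (hj : StronglySeparated (A ++ [j]).toFinset Y) :
    SeparatedFrom (A ++ j :: i :: B) Y := by
  intro P Q hPQ
  rcases append_cons_cons_eq_append hPQ with ⟨A', rfl⟩ | rfl | ⟨B', rfl, rfl⟩
  · exact h P (A' ++ i :: j :: B) (by simp)
  · exact hj
  · have := h (A ++ i :: j :: B') Q (by simp)
    have he : (A ++ j :: i :: B').toFinset = (A ++ i :: j :: B').toFinset :=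
      List.toFinset_eq_of_perm _ _ ((List.Perm.swap i j B').append_left A)
    rwa [he]

/-- If A ∪ {j} fails to precede Y, then Y precedes A ∪ {j}. Since A and A ∪ {i, j} still precede Y,
Y is squeezed to exactly A ∪ {i}. -/
theorem Ahead.flip {Y : Finset (Fin n)} {A B : List (Fin n)} {i j : Fin n} (hij : i < j)
    (hnd : (A ++ i :: j :: B).Nodup)
    (h : Ahead (A ++ i :: j :: B) Y) (hj : StronglySeparated (A ++ [j]).toFinset Y) :
    Ahead (A ++ j :: i :: B) Y ∨ Y = (A ++ [i]).toFinset := by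
  have h0 := h A _ rfl
  have h2 := h (A ++ [i, j]) B (by simp)
  simp only [List.nodup_append, List.nodup_cons, List.mem_cons] at hnd
  have hiA : i ∉ A := by grind
  have hjA : j ∉ A := by grind
  by_cases hp : Precedes (A ++ [j]).toFinset Y
  · left
    intro P Q hPQ
    rcases append_cons_cons_eq_append hPQ with ⟨A', rfl⟩ | rfl | ⟨B', rfl, rfl⟩
    · exact h P (A' ++ i :: j :: B) (by simp)
    · exact hp
    · have := h (A ++ i :: j :: B') Q (by simp)
      have he : (A ++ j :: i :: B').toFinset = (A ++ i :: j :: B').toFinset :=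
        List.toFinset_eq_of_perm _ _ ((List.Perm.swap i j B').append_left A)
      rwa [he]
  · right
    have h1 := hj.resolve_left hp
    simp only [Precedes, List.mem_toFinset, List.mem_append, List.mem_cons,
      List.not_mem_nil, or_false] at h0 h1 h2 hp
    push Not at hp
    obtain ⟨u, hu, huY, v, hv, hvn, huv⟩ := hp
    have hvu : v < u := lt_of_le_of_ne huv (by rintro rfl; exact huY hv)
    have huj : u = j := by
      rcases hu with hu | hu
      · exact absurd (h0 u hu huY v hv (by tauto)) hvu.not_gt
      · exact hu
    subst huj
    have hvi : v = i := by
      by_contra hvi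
      exact absurd (h2 u (by simp) huY v hv (by tauto)) hvu.not_gt
    subst hvi
    have hAY : ∀ a ∈ A, a ∈ Y := by
      intro a ha
      by_contra haY
      exact absurd (h0 a ha haY v hv hiA) (h1 v hv (by tauto) a (Or.inl ha) haY).not_gt
    ext y
    simp only [List.mem_toFinset, List.mem_append, List.mem_singleton]
    constructor
    · intro hy
      by_contra hyn
      have hyu : y ≠ u := by rintro rfl; exact huY hy
      exact absurd (h1 y hy (by tauto) u (by simp) huY)
        (h2 u (by simp) huY y hy (by tauto)).not_gt
    · rintro (hy | rfl)
      · exact hAY y hy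
      · exact hv

/-! ## Sweeping the zonogon -/

/-- The end point of the upward path that starts at the origin and has colours `l`. -/
def pos (ξ : Fin n → Plane) (l : List (Fin n)) : Plane := (l.map ξ).sum

@[simp] theorem pos_nil (ξ : Fin n → Plane) : pos ξ [] = 0 := rfl

@[simp] theorem pos_cons (ξ : Fin n → Plane) (c : Fin n) (l : List (Fin n)) :
    pos ξ (c :: l) = ξ c + pos ξ l := by simp [pos]

@[simp] theorem pos_append (ξ : Fin n → Plane) (A B : List (Fin n)) :
    pos ξ (A ++ B) = pos ξ A + pos ξ B := by simp [pos]

theorem pos_perm (ξ : Fin n → Plane) {A B : List (Fin n)} (h : A.Perm B) : pos ξ A = pos ξ B :=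
  (h.map ξ).sum_eq

/-- `Sweep ξ r l L`: the word `l` is turned into the word `r` by exchanging consecutive letters
`i < j`, one after the other, and the tiles swept by the exchanges form the list `L`. -/
inductive Sweep (ξ : Fin n → Plane) (r : List (Fin n)) : List (Fin n) → List (Tile n) → Prop
  | refl : Sweep ξ r r []
  | flip (A B : List (Fin n)) (i j : Fin n) (h : i < j) (L : List (Tile n)) :
      Sweep ξ r (A ++ j :: i :: B) L →
      Sweep ξ r (A ++ i :: j :: B) (⟨pos ξ A, i, j, h⟩ :: L)

/-- The path with colours `l` has an edge of colour `c` which starts where the path with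
colours `X` ends, both having passed the same set of colours. -/
def HasEdge (l X : List (Fin n)) (c : Fin n) : Prop :=
  ∃ A B, A.Perm X ∧ l = A ++ c :: B

/-- The sum of the sums of the terminal segments of a word. -/
def weight : List (Fin n) → ℕ
  | [] => 0
  | a :: l => a.val + (l.map Fin.val).sum + weight l

/-- Only the terminal segment starting at the second exchanged place changes: its first letter drops
from j to i. -/
theorem weight_flip (A B : List (Fin n)) {i j : Fin n} (h : i < j) :
    weight (A ++ j :: i :: B) < weight (A ++ i :: j :: B) := by
  induction A with
  | nil => simp only [List.nil_append, weight, List.map_cons, List.sum_cons]; omega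
  | cons a A ih =>
    simp only [List.cons_append, weight, List.map_append, List.map_cons, List.sum_append,
      List.sum_cons]
    omega

theorem flip_perm (A B : List (Fin n)) (i j : Fin n) :
    (A ++ j :: i :: B).Perm (A ++ i :: j :: B) :=
  (List.Perm.swap i j B).append_left A

/-- A set not yet passed by the descending word is closed upward, so X and X ∪ {c} are consecutive
initial segments of that word. -/
theorem hasEdge_of_ahead {r X : List (Fin n)} {c : Fin n} (hr : r.Pairwise (· > ·))
    (hall : ∀ x, x ∈ r) (hX : X.Nodup) (hc : c ∉ X) (h1 : Ahead r X.toFinset)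
    (h2 : Ahead r (insert c X.toFinset)) : HasEdge r X c := by
  have upper : ∀ Y : Finset (Fin n), Ahead r Y → ∀ v ∈ Y, ∀ u, v < u → u ∈ Y := by
    intro Y hY v hv u huv
    by_contra hu
    obtain ⟨P, Q, rfl⟩ := List.append_of_mem (hall v)
    have hPv : u ∈ P := by
      have := hall u
      simp only [List.mem_append, List.mem_cons] at this
      rcases this with h | rfl | h
      · exact h
      · exact absurd huv (lt_irrefl _)
      · rw [List.pairwise_append, List.pairwise_cons] at hr
        exact absurd (hr.2.1.1 u h) huv.not_gt
    have hvP : v ∉ P := fun h => by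
      rw [List.pairwise_append] at hr
      exact absurd (hr.2.2 v h v (by simp)) (lt_irrefl _)
    exact absurd (hY P _ rfl u (by simpa using hPv) hu v hv (by simpa using hvP)) huv.not_gt
  obtain ⟨A, B, rfl⟩ := List.append_of_mem (hall c)
  refine ⟨A, B, ?_, rfl⟩
  have hnd : (A ++ c :: B).Nodup := hr.imp fun h => ne_of_gt h
  rw [List.pairwise_append, List.pairwise_cons] at hr
  have hA : A.Nodup := (List.nodup_append.1 hnd).1
  rw [List.perm_ext_iff_of_nodup hA hX]
  intro a
  constructor
  · intro ha
    have hca : c < a := hr.2.2 a ha c (by simp)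
    have := upper _ h2 c (by simp) a hca
    simp only [Finset.mem_insert, List.mem_toFinset] at this
    exact this.resolve_left hca.ne'
  · intro ha
    have := hall a
    simp only [List.mem_append, List.mem_cons] at this
    rcases this with h | rfl | h
    · exact h
    · exact absurd ha hc
    · have hac : a < c := hr.2.1.1 a h
      have := upper _ h1 a (by simpa using ha) c hac
      exact absurd (by simpa using this) hc

/-- The recursion carries along the edges both of whose ends are still ahead of the path. An edge
drops out when an exchange passes one of its ends, and is then a left edge of the new tile. -/
theorem exists_sweep (ξ : Fin n → Plane) (S : Set (Finset (Fin n)))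
    (hS : ∀ X ∈ S, ∀ Y ∈ S, StronglySeparated X Y) (r : List (Fin n)) (hr : r.Pairwise (· > ·))
    (l : List (Fin n)) (hl : l.Nodup) (hall : ∀ x, x ∈ l) (hlr : l.Perm r)
    (hsep : ∀ Y ∈ S, SeparatedFrom l Y) :
    ∃ L, Sweep ξ r l L ∧ ∀ (X : List (Fin n)) (c : Fin n), X.Nodup → c ∉ X →
      X.toFinset ∈ S → insert c X.toFinset ∈ S → Ahead l X.toFinset →
      Ahead l (insert c X.toFinset) →
      (∃ t ∈ L, (⟨pos ξ X, c⟩ : Edge n) ∈ t.edges ξ) ∨ HasEdge r X c := by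
  by_cases hd : l.Pairwise (· > ·)
  · have : l = r := hlr.eq_of_pairwise' hd hr
    subst this
    exact ⟨[], .refl, fun X c hX hc _ _ h1 h2 => Or.inr (hasEdge_of_ahead hr hall hX hc h1 h2)⟩
  · obtain ⟨A, B, i, j, rfl, hij, hj⟩ := exists_unblocked_ascent S hS l hl hall hsep hd
    have hp := flip_perm A B i j
    have hw := weight_flip A B hij
    obtain ⟨L, hL, hcov⟩ := exists_sweep ξ S hS r hr (A ++ j :: i :: B) (hp.nodup_iff.2 hl)
      (fun x => hp.mem_iff.2 (hall x)) (hp.trans hlr) fun Y hY => (hsep Y hY).flip (hj Y hY)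
    refine ⟨_, .flip A B i j hij L hL, fun X c hX hc hXS hcS h1 h2 => ?_⟩
    have hnd := hl
    simp only [List.nodup_append, List.nodup_cons, List.mem_cons] at hnd
    have hiA : i ∉ A := by grind
    have hjA : j ∉ A := by grind
    have hA : A.Nodup := hnd.1
    have hAi : (A ++ [i]).Nodup := List.Nodup.sublist (by simp) hl
    have s1 := hj _ hXS
    have s2 := hj _ hcS
    -- An end that is passed equals A ∪ {i}. If it is the upper end, the edge must be the tile's
    -- lower left edge; if the lower end, its upper left edge. Any other colour contradicts the
    -- separation of A ∪ {j} from the other end.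
    rcases h1.flip hij hl s1 with h1' | h1'
    · rcases h2.flip hij hl s2 with h2' | h2'
      · rcases hcov X c hX hc hXS hcS h1' h2' with ⟨t, ht, he⟩ | h
        · exact Or.inl ⟨t, List.mem_cons_of_mem _ ht, he⟩
        · exact Or.inr h
      · left
        by_cases hci : c = i
        · subst hci
          have hXA : X.Perm A := by
            rw [List.perm_ext_iff_of_nodup hX hA]
            intro a
            have := congrArg (a ∈ ·) h2'
            simp only [Finset.mem_insert, List.mem_toFinset, List.mem_append,
              List.mem_singleton] at this
            grind
          refine ⟨_, List.mem_cons_self, ?_⟩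
          simp [Tile.edges, pos_perm ξ hXA]
        · exfalso
          have hm : ∀ a, (a = c ∨ a ∈ X) ↔ (a ∈ A ∨ a = i) := fun a => by
            have := congrArg (a ∈ ·) h2'
            simpa [or_comm] using this
          have hcA : c ∈ A := ((hm c).1 (Or.inl rfl)).resolve_right hci
          have hiX : i ∈ X := ((hm i).2 (Or.inr rfl)).resolve_left (Ne.symm hci)
          have hc_lt : c < i := h1 A _ rfl c (by simpa) (by simpa) i (by simpa) (by simpa)
          have hjX : j ∉ X := fun h => ((hm j).1 (Or.inr h)).elim hjA hij.ne'
          rcases s1 with s | s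
          · exact absurd (s j (by simp) (by simpa) i (by simpa) (by simp [hiA, hij.ne]))
              hij.not_gt
          · exact absurd (s i (by simpa) (by simp [hiA, hij.ne]) c (by simp [hcA]) (by simpa))
              hc_lt.not_gt
    · left
      have hXA : X.Perm (A ++ [i]) := List.perm_of_nodup_nodup_toFinset_eq hX hAi h1'
      by_cases hcj : c = j
      · subst hcj
        refine ⟨_, List.mem_cons_self, ?_⟩
        simp [Tile.edges, pos_perm ξ hXA]
      · exfalso
        have hcA : c ∉ A ∧ c ≠ i := by
          have := mt hXA.mem_iff.2 hc
          simpa using this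
        have hjX : j ∉ X := fun h => by
          have := hXA.mem_iff.1 h
          simp only [List.mem_append, List.mem_singleton] at this
          exact this.elim hjA hij.ne'
        have hiX : i ∈ X := hXA.mem_iff.2 (by simp)
        have hjc : j < c := h2 (A ++ [i, j]) B (by simp) j (by simp)
          (by simp [hjX, Ne.symm hcj]) c (by simp) (by simp [hcA, hcj])
        rcases s2 with s | s
        · exact absurd (s j (by simp) (by simp [hjX, Ne.symm hcj]) i (by simp [hiX])
            (by simp [hiA, hij.ne])) hij.not_gt
        · exact absurd (s c (by simp) (by simp [hcA, hcj]) j (by simp)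
            (by simp [hjX, Ne.symm hcj])) hjc.not_gt
termination_by weight l

/-! ## Paths as graphs over the height -/

/-- The horizontal coordinate, at height `y`, of the path from the origin with colours `l`. -/
noncomputable def abscissa (ξ : Fin n → Plane) : List (Fin n) → ℝ → ℝ
  -- With this value the graph stays constant above the top vertex. Below height 0 the first edge is
  -- merely prolonged, whence the assumptions of nonnegative height below.
  | [], _ => 0
  | c :: l, y => if y ≤ ξ c 1 then ξ c 0 / ξ c 1 * y else ξ c 0 + abscissa ξ l (y - ξ c 1)

theorem plane_ext {p q : Plane} (h0 : p 0 = q 0) (h1 : p 1 = q 1) : p = q := by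
  ext k; fin_cases k <;> assumption

theorem IsFan.slope_lt (hξ : IsFan ξ) {i j : Fin n} (h : i < j) :
    ξ i 0 / ξ i 1 < ξ j 0 / ξ j 1 := by
  rw [div_lt_div_iff₀ (hξ.upper i) (hξ.upper j)]
  have := hξ.clockwise i j h
  linarith

theorem IsFan.slope_mul (hξ : IsFan ξ) (c : Fin n) : ξ c 0 / ξ c 1 * ξ c 1 = ξ c 0 :=
  div_mul_cancel₀ _ (hξ.upper c).ne'

theorem pos_height_nonneg (hξ : IsFan ξ) (l : List (Fin n)) : 0 ≤ pos ξ l 1 := by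
  induction l with
  | nil => simp
  | cons c l ih =>
    have := hξ.upper c
    simp only [pos_cons, PiLp.add_apply]; linarith

theorem abscissa_zero (hξ : IsFan ξ) (l : List (Fin n)) : abscissa ξ l 0 = 0 := by
  cases l with
  | nil => rfl
  | cons c l => simp [abscissa, (hξ.upper c).le]

theorem abscissa_cons_add (hξ : IsFan ξ) (c : Fin n) (l : List (Fin n)) {z : ℝ} (hz : 0 ≤ z) :
    abscissa ξ (c :: l) (ξ c 1 + z) = ξ c 0 + abscissa ξ l z := by
  rcases hz.eq_or_lt with rfl | hz
  · simp [abscissa, abscissa_zero hξ, hξ.slope_mul]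
  · simp [abscissa, hz]

theorem abscissa_append_add (hξ : IsFan ξ) (A l : List (Fin n)) {z : ℝ} (hz : 0 ≤ z) :
    abscissa ξ (A ++ l) (pos ξ A 1 + z) = pos ξ A 0 + abscissa ξ l z := by
  induction A with
  | nil => simp
  | cons c A ih =>
    have h := pos_height_nonneg hξ A
    rw [List.cons_append, pos_cons, PiLp.add_apply, PiLp.add_apply, add_assoc,
      abscissa_cons_add hξ c _ (by linarith), ih, add_assoc]

theorem abscissa_append_of_le (hξ : IsFan ξ) (A l l' : List (Fin n)) {y : ℝ} (hy : 0 ≤ y)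
    (h : y ≤ pos ξ A 1) : abscissa ξ (A ++ l) y = abscissa ξ (A ++ l') y := by
  induction A generalizing y with
  | nil =>
    have : y = 0 := le_antisymm (by simpa using h) hy
    simp [this, abscissa_zero hξ]
  | cons c A ih =>
    simp only [List.cons_append, abscissa]
    split_ifs with hc
    · rfl
    · rw [ih (by linarith) (by simp only [pos_cons, PiLp.add_apply] at h; linarith)]

theorem abscissa_vertex (hξ : IsFan ξ) (A l : List (Fin n)) :
    abscissa ξ (A ++ l) (pos ξ A 1) = pos ξ A 0 := by
  simpa [abscissa_zero hξ] using abscissa_append_add hξ A l le_rfl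

theorem abscissa_edge (hξ : IsFan ξ) (A : List (Fin n)) (c : Fin n) (B : List (Fin n)) {t : ℝ}
    (h0 : 0 ≤ t) (h1 : t ≤ 1) :
    abscissa ξ (A ++ c :: B) ((pos ξ A + t • ξ c) 1) = (pos ξ A + t • ξ c) 0 := by
  have hc := hξ.upper c
  have ht : t * ξ c 1 ≤ ξ c 1 := by nlinarith
  simp only [PiLp.add_apply, PiLp.smul_apply, smul_eq_mul]
  rw [abscissa_append_add hξ A _ (by positivity), abscissa, if_pos ht, mul_left_comm,
    hξ.slope_mul]

/-! ## Exchanging two colours -/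

theorem abscissa_cons_of_le {c : Fin n} (B : List (Fin n)) {y : ℝ} (h : y ≤ ξ c 1) :
    abscissa ξ (c :: B) y = ξ c 0 / ξ c 1 * y := by
  rw [abscissa, if_pos h]

theorem abscissa_cons_cons_of_le (hξ : IsFan ξ) {c d : Fin n} (B : List (Fin n)) {y : ℝ}
    (h : ξ c 1 ≤ y) (h' : y ≤ ξ c 1 + ξ d 1) :
    abscissa ξ (c :: d :: B) y = ξ c 0 + ξ d 0 / ξ d 1 * (y - ξ c 1) := by
  have := abscissa_cons_add hξ c (d :: B) (z := y - ξ c 1) (by linarith)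
  rwa [add_sub_cancel, abscissa_cons_of_le B (by linarith)] at this

theorem abscissa_ascent (hξ : IsFan ξ) {i j : Fin n} (hij : i < j) (B : List (Fin n)) {y : ℝ}
    (h : y ≤ ξ i 1 + ξ j 1) :
    abscissa ξ (i :: j :: B) y =
      max (ξ i 0 / ξ i 1 * y) (ξ i 0 + ξ j 0 / ξ j 1 * (y - ξ i 1)) := by
  have hs := hξ.slope_lt hij
  have hi := hξ.slope_mul i
  rcases le_total y (ξ i 1) with hy | hy
  · rw [abscissa_cons_of_le _ hy, max_eq_left]
    nlinarith [mul_nonneg (sub_nonneg.2 hs.le) (sub_nonneg.2 hy)]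
  · rw [abscissa_cons_cons_of_le hξ _ hy h, max_eq_right]
    nlinarith [mul_nonneg (sub_nonneg.2 hs.le) (sub_nonneg.2 hy)]

theorem abscissa_descent (hξ : IsFan ξ) {i j : Fin n} (hij : i < j) (B : List (Fin n)) {y : ℝ}
    (h : y ≤ ξ i 1 + ξ j 1) :
    abscissa ξ (j :: i :: B) y =
      min (ξ j 0 / ξ j 1 * y) (ξ j 0 + ξ i 0 / ξ i 1 * (y - ξ j 1)) := by
  have hs := hξ.slope_lt hij
  have hj := hξ.slope_mul j
  rcases le_total y (ξ j 1) with hy | hy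
  · rw [abscissa_cons_of_le _ hy, min_eq_left]
    nlinarith [mul_nonneg (sub_nonneg.2 hs.le) (sub_nonneg.2 hy)]
  · rw [abscissa_cons_cons_of_le hξ _ hy (by linarith), min_eq_right]
    nlinarith [mul_nonneg (sub_nonneg.2 hs.le) (sub_nonneg.2 hy)]

theorem abscissa_ascent_lt_descent (hξ : IsFan ξ) {i j : Fin n} (hij : i < j)
    (B : List (Fin n)) {y : ℝ} (h0 : 0 < y) (h : y < ξ i 1 + ξ j 1) :
    abscissa ξ (i :: j :: B) y < abscissa ξ (j :: i :: B) y := by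
  rw [abscissa_ascent hξ hij B h.le, abscissa_descent hξ hij B h.le]
  have hs := sub_pos.2 (hξ.slope_lt hij)
  have hi := hξ.slope_mul i
  have hj := hξ.slope_mul j
  have h1 := mul_pos hs h0
  have h2 := mul_pos hs (hξ.upper i)
  have h3 := mul_pos hs (hξ.upper j)
  have h4 := mul_pos hs (sub_pos.2 h)
  refine max_lt (lt_min ?_ ?_) (lt_min ?_ ?_) <;> nlinarith

theorem abscissa_ascent_eq_descent (hξ : IsFan ξ) (i j : Fin n)
    (B : List (Fin n)) {y : ℝ} (h : ξ i 1 + ξ j 1 ≤ y) :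
    abscissa ξ (i :: j :: B) y = abscissa ξ (j :: i :: B) y := by
  have hz : 0 ≤ y - (ξ i 1 + ξ j 1) := by linarith
  have e1 := abscissa_append_add hξ [i, j] B hz
  have e2 := abscissa_append_add hξ [j, i] B hz
  simp only [List.cons_append, List.nil_append, pos_cons, pos_nil, PiLp.add_apply, add_zero] at e1 e2
  rw [add_sub_cancel] at e1
  rw [add_comm (ξ j 1), add_sub_cancel] at e2
  rw [e1, e2, add_comm (ξ j 0)]

theorem exists_combination_iff (hξ : IsFan ξ) {i j : Fin n} (hij : i < j) (B : List (Fin n))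
    (q : Plane) :
    (∃ a b : ℝ, (0 ≤ a ∧ a ≤ 1) ∧ (0 ≤ b ∧ b ≤ 1) ∧ q = a • ξ i + b • ξ j) ↔
      0 ≤ q 1 ∧ q 1 ≤ ξ i 1 + ξ j 1 ∧ abscissa ξ (i :: j :: B) (q 1) ≤ q 0 ∧
        q 0 ≤ abscissa ξ (j :: i :: B) (q 1) := by
  have hs := sub_pos.2 (hξ.slope_lt hij)
  have hi := hξ.slope_mul i
  have hj := hξ.slope_mul j
  have hiu := hξ.upper i
  have hju := hξ.upper j
  generalize hsi : ξ i 0 / ξ i 1 = s at *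
  generalize hsj : ξ j 0 / ξ j 1 = r at *
  have hs_i := mul_pos hs hiu
  have hs_j := mul_pos hs hju
  constructor
  · rintro ⟨a, b, ⟨ha, ha'⟩, ⟨hb, hb'⟩, rfl⟩
    simp only [PiLp.add_apply, PiLp.smul_apply, smul_eq_mul]
    have h1 : a * ξ i 1 ≤ ξ i 1 := mul_le_of_le_one_left hiu.le ha'
    have h2 : b * ξ j 1 ≤ ξ j 1 := mul_le_of_le_one_left hju.le hb'
    have h3 := mul_nonneg ha hs_i.le
    have h4 := mul_nonneg hb hs_j.le
    have h5 := mul_nonneg (sub_nonneg.2 ha') hs_i.le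
    have h6 := mul_nonneg (sub_nonneg.2 hb') hs_j.le
    refine ⟨by positivity, by linarith, ?_, ?_⟩
    · rw [abscissa_ascent hξ hij B (by linarith), hsi, hsj, ← hi, ← hj]
      apply max_le <;> nlinarith
    · rw [abscissa_descent hξ hij B (by linarith), hsi, hsj, ← hi, ← hj]
      apply le_min <;> nlinarith
  · rintro ⟨h0, h1, h2, h3⟩
    rw [abscissa_ascent hξ hij B h1, max_le_iff, hsi, hsj, ← hi] at h2
    rw [abscissa_descent hξ hij B h1, le_min_iff, hsi, hsj, ← hj] at h3
    -- The coefficients come from Cramer's rule, written with the slopes `s` and `r` of the two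
    -- vectors.
    refine ⟨(r * q 1 - q 0) / ((r - s) * ξ i 1), (q 0 - s * q 1) / ((r - s) * ξ j 1),
      ⟨div_nonneg (by linarith) hs_i.le, ?_⟩, ⟨div_nonneg (by linarith) hs_j.le, ?_⟩, ?_⟩
    · rw [div_le_one hs_i]; linarith
    · rw [div_le_one hs_j]; linarith
    · apply plane_ext <;> simp only [PiLp.add_apply, PiLp.smul_apply, smul_eq_mul]
      · rw [← hi, ← hj]; field_simp; ring
      · field_simp; ring

section Flip

variable {i j : Fin n} (A B : List (Fin n)) {y : ℝ}

theorem abscissa_flip_lt (hξ : IsFan ξ) (hij : i < j) (h0 : pos ξ A 1 < y)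
    (h1 : y < pos ξ A 1 + ξ i 1 + ξ j 1) :
    abscissa ξ (A ++ i :: j :: B) y < abscissa ξ (A ++ j :: i :: B) y := by
  obtain ⟨z, rfl⟩ : ∃ z, y = pos ξ A 1 + z := ⟨y - pos ξ A 1, by ring⟩
  rw [abscissa_append_add hξ _ _ (by linarith), abscissa_append_add hξ _ _ (by linarith)]
  have := abscissa_ascent_lt_descent hξ hij B (y := z) (by linarith) (by linarith)
  linarith

theorem abscissa_flip_eq (hξ : IsFan ξ) (hy : 0 ≤ y)
    (h : y ≤ pos ξ A 1 ∨ pos ξ A 1 + ξ i 1 + ξ j 1 ≤ y) :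
    abscissa ξ (A ++ i :: j :: B) y = abscissa ξ (A ++ j :: i :: B) y := by
  rcases h with h | h
  · exact abscissa_append_of_le hξ A _ _ hy h
  · obtain ⟨z, rfl⟩ : ∃ z, y = pos ξ A 1 + z := ⟨y - pos ξ A 1, by ring⟩
    have := hξ.upper i
    have := hξ.upper j
    rw [abscissa_append_add hξ _ _ (by linarith), abscissa_append_add hξ _ _ (by linarith),
      abscissa_ascent_eq_descent hξ i j B (by linarith)]

theorem abscissa_flip_le (hξ : IsFan ξ) (hij : i < j) (hy : 0 ≤ y) :
    abscissa ξ (A ++ i :: j :: B) y ≤ abscissa ξ (A ++ j :: i :: B) y := by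
  by_cases h : y ≤ pos ξ A 1 ∨ pos ξ A 1 + ξ i 1 + ξ j 1 ≤ y
  · exact (abscissa_flip_eq A B hξ hy h).le
  · push Not at h
    exact (abscissa_flip_lt A B hξ hij h.1 h.2).le

/-- The continuation `B` is arbitrary: between the bottom and top heights of the tile it does not
affect either graph. -/
theorem mem_tile_iff (hξ : IsFan ξ) (hij : i < j) (p : Plane) :
    p ∈ (⟨pos ξ A, i, j, hij⟩ : Tile n).carrier ξ ↔
      pos ξ A 1 ≤ p 1 ∧ p 1 ≤ pos ξ A 1 + ξ i 1 + ξ j 1 ∧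
        abscissa ξ (A ++ i :: j :: B) (p 1) ≤ p 0 ∧
        p 0 ≤ abscissa ξ (A ++ j :: i :: B) (p 1) := by
  obtain ⟨q, rfl⟩ : ∃ q, p = pos ξ A + q := ⟨p - pos ξ A, by abel⟩
  have h1 : pos ξ A + q ∈ (⟨pos ξ A, i, j, hij⟩ : Tile n).carrier ξ ↔
      ∃ a b : ℝ, (0 ≤ a ∧ a ≤ 1) ∧ (0 ≤ b ∧ b ≤ 1) ∧ q = a • ξ i + b • ξ j := by
    simp only [Tile.carrier, Set.mem_ofPred_eq, add_assoc, add_right_inj]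
  rw [h1, exists_combination_iff hξ hij B]
  simp only [PiLp.add_apply]
  constructor
  · rintro ⟨h0, h2, h3, h4⟩
    rw [abscissa_append_add hξ _ _ h0, abscissa_append_add hξ _ _ h0]
    exact ⟨by linarith, by linarith, by linarith, by linarith⟩
  · rintro ⟨h0, h2, h3, h4⟩
    have h0' : 0 ≤ q 1 := by linarith
    rw [abscissa_append_add hξ _ _ h0'] at h3 h4
    exact ⟨by linarith, by linarith, by linarith, by linarith⟩

end Flip

/-! ## Tiles met by a path -/

/-- Each exchange moves the graph weakly to the right, so a tile swept later stays on the right of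
every earlier path. -/
theorem Sweep.abscissa_le (hξ : IsFan ξ) {r l : List (Fin n)} {L : List (Tile n)}
    (h : Sweep ξ r l L) {t : Tile n} (ht : t ∈ L) {p : Plane} (hp : p ∈ t.carrier ξ) :
    0 ≤ p 1 ∧ abscissa ξ l (p 1) ≤ p 0 := by
  induction h with
  | refl => simp at ht
  | flip A B i j hij L _ ih =>
    rcases List.mem_cons.1 ht with rfl | ht
    · have h := (mem_tile_iff A B hξ hij p).1 hp
      exact ⟨(pos_height_nonneg hξ A).trans h.1, h.2.2.1⟩
    · have := ih ht
      exact ⟨this.1, (abscissa_flip_le A B hξ hij this.1).trans this.2⟩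

theorem append_cons_cons_eq_append_cons {A B P Q : List (Fin n)} {i j c : Fin n}
    (h : A ++ i :: j :: B = P ++ c :: Q) :
    (∃ A', A = P ++ c :: A') ∨ (P = A ∧ c = i) ∨ (P = A ++ [i] ∧ c = j) ∨
      ∃ B', P = A ++ i :: j :: B' ∧ B = B' ++ c :: Q := by
  rcases append_cons_cons_eq_append h with ⟨A', rfl⟩ | rfl | h'
  · rcases A' with _ | ⟨a, A'⟩
    · simp at h; simp [h.1]
    · simp at h; simp [h.1]
  · simp at h; simp [h.1]
  · exact Or.inr (Or.inr (Or.inr h'))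

/-- The tile of the exchange meets the heights of the other edges at most at their ends. For a later
tile, the interiors of the two exchanged edges lie strictly left of the new path and hence outside
it, while all other edges survive on that path. -/
theorem Sweep.edge_of_mem (hξ : IsFan ξ) {r l : List (Fin n)} {L : List (Tile n)}
    (h : Sweep ξ r l L) {t : Tile n} (ht : t ∈ L) {P Q : List (Fin n)} {c : Fin n}
    (hl : l = P ++ c :: Q) {a : ℝ} (h0 : 0 < a) (h1 : a < 1)
    (hp : pos ξ P + a • ξ c ∈ t.carrier ξ) : (⟨pos ξ P, c⟩ : Edge n) ∈ t.edges ξ := by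
  induction h generalizing P Q with
  | refl => simp at ht
  | flip A B i j hij L hL ih =>
    have hc := hξ.upper c
    have hac : 0 < a * ξ c 1 := mul_pos h0 hc
    have hac' : a * ξ c 1 < ξ c 1 := by nlinarith
    have hiu := hξ.upper i
    have hju := hξ.upper j
    have he := abscissa_edge hξ P c Q h0.le h1.le
    rw [← hl] at he
    have hcases := append_cons_cons_eq_append_cons hl
    rcases List.mem_cons.1 ht with rfl | htL
    · obtain ⟨h2, h3, -⟩ := (mem_tile_iff A B hξ hij _).1 hp
      simp only [PiLp.add_apply, PiLp.smul_apply, smul_eq_mul] at h2 h3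
      rcases hcases with ⟨A', rfl⟩ | ⟨rfl, rfl⟩ | ⟨rfl, rfl⟩ | ⟨B', rfl, rfl⟩
      · have := pos_height_nonneg hξ A'
        simp only [pos_append, pos_cons, PiLp.add_apply] at h2
        linarith
      · simp [Tile.edges]
      · simp [Tile.edges]
      · have := pos_height_nonneg hξ B'
        simp only [pos_append, pos_cons, PiLp.add_apply] at h3
        linarith
    · obtain ⟨hp0, hle⟩ := hL.abscissa_le hξ htL hp
      have hlt : ¬ (pos ξ A 1 < (pos ξ P + a • ξ c) 1 ∧
          (pos ξ P + a • ξ c) 1 < pos ξ A 1 + ξ i 1 + ξ j 1) := fun h =>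
        absurd (abscissa_flip_lt A B hξ hij h.1 h.2) (by rw [he]; exact hle.not_gt)
      simp only [PiLp.add_apply, PiLp.smul_apply, smul_eq_mul] at hlt
      rcases hcases with ⟨A', rfl⟩ | ⟨rfl, rfl⟩ | ⟨rfl, rfl⟩ | ⟨B', rfl, rfl⟩
      · exact ih htL (P := P) (Q := A' ++ j :: i :: B) (by simp) hp
      · exact absurd ⟨by linarith, by linarith⟩ hlt
      · simp only [pos_append, pos_cons, pos_nil, PiLp.add_apply, add_zero] at hlt
        exact absurd ⟨by linarith, by linarith⟩ hlt
      · have hpos := pos_perm ξ (flip_perm A B' i j)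
        rw [← hpos] at hp ⊢
        exact ih htL (P := A ++ j :: i :: B') (Q := Q) (by simp) hp

theorem Sweep.vertex_of_mem (hξ : IsFan ξ) {r l : List (Fin n)} {L : List (Tile n)}
    (h : Sweep ξ r l L) {t : Tile n} (ht : t ∈ L) {P Q : List (Fin n)}
    (hl : l = P ++ Q) (hp : pos ξ P ∈ t.carrier ξ) : pos ξ P ∈ t.vertices ξ := by
  induction h generalizing P Q with
  | refl => simp at ht
  | flip A B i j hij L hL ih =>
    have hiu := hξ.upper i
    have hju := hξ.upper j
    have he := abscissa_vertex hξ P Q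
    rw [← hl] at he
    have hcases := append_cons_cons_eq_append hl
    rcases List.mem_cons.1 ht with rfl | htL
    · obtain ⟨h2, h3, -⟩ := (mem_tile_iff A B hξ hij _).1 hp
      rcases hcases with ⟨A', rfl⟩ | rfl | ⟨B', rfl, rfl⟩
      · rcases A' with _ | ⟨c, A'⟩
        · simp [Tile.vertices]
        · have := pos_height_nonneg hξ A'
          have := hξ.upper c
          simp only [pos_append, pos_cons, PiLp.add_apply] at h2
          linarith
      · simp [Tile.vertices]
      · rcases B' with _ | ⟨c, B'⟩
        · simp [Tile.vertices, add_assoc]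
        · have := pos_height_nonneg hξ B'
          have := hξ.upper c
          simp only [pos_append, pos_cons, PiLp.add_apply] at h3
          linarith
    · obtain ⟨hp0, hle⟩ := hL.abscissa_le hξ htL hp
      have hlt : ¬ (pos ξ A 1 < pos ξ P 1 ∧ pos ξ P 1 < pos ξ A 1 + ξ i 1 + ξ j 1) := fun h =>
        absurd (abscissa_flip_lt A B hξ hij h.1 h.2) (by rw [he]; exact hle.not_gt)
      rcases hcases with ⟨A', rfl⟩ | rfl | ⟨B', rfl, rfl⟩
      · exact ih htL (P := P) (Q := A' ++ j :: i :: B) (by simp) hp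
      · simp only [pos_append, pos_cons, pos_nil, PiLp.add_apply, add_zero] at hlt
        exact absurd ⟨by linarith, by linarith⟩ hlt
      · have hpos := pos_perm ξ (flip_perm A B' i j)
        rw [← hpos] at hp ⊢
        exact ih htL (P := A ++ j :: i :: B') (Q := Q) (by simp) hp

/-! ## Intersections of tiles -/

theorem Edge.mem_carrier_iff (e : Edge n) (p : Plane) :
    p ∈ e.carrier ξ ↔ ∃ a : ℝ, 0 ≤ a ∧ a ≤ 1 ∧ p = e.tail + a • ξ e.color := by
  simp only [Edge.carrier, Edge.head, segment_eq_image', add_sub_cancel_left, Set.mem_image,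
    Set.mem_Icc]
  constructor
  · rintro ⟨a, ⟨h0, h1⟩, rfl⟩; exact ⟨a, h0, h1, rfl⟩
  · rintro ⟨a, h0, h1, rfl⟩; exact ⟨a, ⟨h0, h1⟩, rfl⟩

theorem Edge.tail_mem_carrier (e : Edge n) : e.tail ∈ e.carrier ξ := left_mem_segment ℝ _ _

theorem Edge.head_mem_carrier (e : Edge n) : e.head ξ ∈ e.carrier ξ := right_mem_segment ℝ _ _

theorem Tile.convex_carrier (t : Tile n) : Convex ℝ (t.carrier ξ) := by
  rintro _ ⟨a, b, ⟨ha, ha'⟩, ⟨hb, hb'⟩, rfl⟩ _ ⟨c, d, ⟨hc, hc'⟩, ⟨hd, hd'⟩, rfl⟩ u v hu hv huv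
  refine ⟨u * a + v * c, u * b + v * d, ⟨by positivity, by nlinarith⟩,
    ⟨by positivity, by nlinarith⟩, ?_⟩
  obtain rfl : v = 1 - u := by linarith
  module

theorem Tile.edge_subset (t : Tile n) {e : Edge n} (he : e ∈ t.edges ξ) :
    e.carrier ξ ⊆ t.carrier ξ := by
  intro p hp
  obtain ⟨a, h0, h1, rfl⟩ := (e.mem_carrier_iff p).1 hp
  rcases he with rfl | rfl | rfl | rfl
  · exact ⟨a, 0, ⟨h0, h1⟩, by norm_num, by simp⟩
  · exact ⟨0, a, by norm_num, ⟨h0, h1⟩, by simp⟩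
  · exact ⟨a, 1, ⟨h0, h1⟩, by norm_num, by simp only; module⟩
  · exact ⟨1, a, by norm_num, ⟨h0, h1⟩, by simp only; module⟩

theorem Tile.eq_of_right_edges (hξ : IsFan ξ) {p : Plane} {i j : Fin n} (hij : i < j) {t : Tile n}
    (h1 : (⟨p, j⟩ : Edge n) ∈ t.edges ξ) (h2 : (⟨p + ξ j, i⟩ : Edge n) ∈ t.edges ξ) :
    t = ⟨p, i, j, hij⟩ := by
  obtain ⟨q, i', j', hij'⟩ := t
  have hi := hξ.upper i
  have hj := hξ.upper j
  simp only [Tile.edges, Set.mem_insert_iff, Set.mem_singleton_iff, Edge.mk.injEq] at h1 h2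
  have key : i = i' ∧ j = j' := by
    rcases h1 with ⟨-, rfl⟩ | ⟨-, rfl⟩ | ⟨-, rfl⟩ | ⟨-, rfl⟩ <;>
    rcases h2 with ⟨-, rfl⟩ | ⟨-, rfl⟩ | ⟨-, rfl⟩ | ⟨-, rfl⟩ <;>
    first
      | exact ⟨rfl, rfl⟩
      | exact absurd hij (lt_irrefl _)
      | exact absurd hij hij'.not_gt
  obtain ⟨rfl, rfl⟩ := key
  have hne : j ≠ i := hij.ne'
  simp only [hne, hne.symm, and_false, or_false, and_true, false_or] at h1 h2
  rcases h1 with rfl | rfl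
  · rfl
  · exfalso
    rcases h2 with h | h
    · have := congrArg (fun v : Plane => v 1) h
      simp only [PiLp.add_apply] at this
      linarith
    · have := congrArg (fun v : Plane => v 1) h
      simp only [PiLp.add_apply] at this
      linarith

/-- The tiles `s` and `t` are disjoint or have in common exactly one vertex or exactly one closed
edge. -/
def MeetProperly (ξ : Fin n → Plane) (s t : Tile n) : Prop :=
  (s.carrier ξ ∩ t.carrier ξ).Nonempty →
    (∃ v, v ∈ s.vertices ξ ∧ v ∈ t.vertices ξ ∧ s.carrier ξ ∩ t.carrier ξ = {v}) ∨
    (∃ e, e ∈ s.edges ξ ∧ e ∈ t.edges ξ ∧ s.carrier ξ ∩ t.carrier ξ = e.carrier ξ)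

theorem MeetProperly.symm {s t : Tile n} (h : MeetProperly ξ s t) : MeetProperly ξ t s := by
  intro hne
  rw [Set.inter_comm] at hne
  rcases h hne with ⟨v, h1, h2, h3⟩ | ⟨e, h1, h2, h3⟩
  · exact Or.inl ⟨v, h2, h1, by rw [Set.inter_comm, h3]⟩
  · exact Or.inr ⟨e, h2, h1, by rw [Set.inter_comm, h3]⟩

theorem mem_right_edges (hξ : IsFan ξ) {i j : Fin n} (A B : List (Fin n)) {p : Plane}
    (h0 : pos ξ A 1 ≤ p 1) (h1 : p 1 ≤ pos ξ A 1 + ξ i 1 + ξ j 1)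
    (h : p 0 = abscissa ξ (A ++ j :: i :: B) (p 1)) :
    p ∈ (⟨pos ξ A, j⟩ : Edge n).carrier ξ ∨ p ∈ (⟨pos ξ A + ξ j, i⟩ : Edge n).carrier ξ := by
  obtain ⟨q, rfl⟩ : ∃ q, p = pos ξ A + q := ⟨p - pos ξ A, by abel⟩
  have hi := hξ.upper i
  have hj := hξ.upper j
  simp only [PiLp.add_apply] at h0 h1 h
  have hq : 0 ≤ q 1 := by linarith
  rw [abscissa_append_add hξ _ _ hq, add_right_inj] at h
  rcases le_total (q 1) (ξ j 1) with hle | hle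
  · left
    refine (Edge.mem_carrier_iff _ _).2 ⟨q 1 / ξ j 1, by positivity, (div_le_one hj).2 hle, ?_⟩
    rw [abscissa_cons_of_le _ hle] at h
    simp only [add_right_inj]
    apply plane_ext <;> simp only [PiLp.smul_apply, smul_eq_mul]
    · rw [h]; ring
    · field_simp
  · right
    refine (Edge.mem_carrier_iff _ _).2 ⟨(q 1 - ξ j 1) / ξ i 1,
      div_nonneg (by linarith) hi.le, (div_le_one hi).2 (by linarith), ?_⟩
    rw [abscissa_cons_cons_of_le hξ _ hle (by linarith)] at h
    simp only [add_right_inj, add_assoc]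
    apply plane_ext <;> simp only [PiLp.add_apply, PiLp.smul_apply, smul_eq_mul]
    · rw [h]; ring
    · field_simp; ring

/-- The intersection is convex and lies on the two right edges of the first tile. An interior point
of one of these makes it an edge of `t`, and `t` cannot have both, as it would then be the same
tile. So the intersection is one whole edge or a single vertex. -/
theorem Sweep.meetProperly_head (hξ : IsFan ξ) {r A B : List (Fin n)} {i j : Fin n} (hij : i < j)
    {L : List (Tile n)} (hL : Sweep ξ r (A ++ j :: i :: B) L) {t : Tile n} (ht : t ∈ L)
    (hne : (⟨pos ξ A, i, j, hij⟩ : Tile n) ≠ t) :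
    MeetProperly ξ ⟨pos ξ A, i, j, hij⟩ t := by
  intro hI
  set s : Tile n := ⟨pos ξ A, i, j, hij⟩ with hs
  set e₁ : Edge n := ⟨pos ξ A, j⟩ with he₁
  set e₂ : Edge n := ⟨pos ξ A + ξ j, i⟩ with he₂
  have hs₁ : e₁ ∈ s.edges ξ := by simp [Tile.edges, hs, he₁]
  have hs₂ : e₂ ∈ s.edges ξ := by simp [Tile.edges, hs, he₂]
  have hAj : pos ξ (A ++ [j]) = pos ξ A + ξ j := by simp
  have hAji : pos ξ (A ++ [j, i]) = pos ξ A + ξ j + ξ i := by simp [add_assoc]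
  have hconv : Convex ℝ (s.carrier ξ ∩ t.carrier ξ) := s.convex_carrier.inter t.convex_carrier
  have hright : ∀ p ∈ s.carrier ξ ∩ t.carrier ξ, p ∈ e₁.carrier ξ ∨ p ∈ e₂.carrier ξ := by
    rintro p ⟨hp, hp'⟩
    obtain ⟨h0, h1, -, h2⟩ := (mem_tile_iff A B hξ hij p).1 hp
    exact mem_right_edges hξ A B h0 h1 (le_antisymm h2 (hL.abscissa_le hξ ht hp').2)
  have hE₁ : ∀ a : ℝ, 0 < a → a < 1 → pos ξ A + a • ξ j ∈ s.carrier ξ ∩ t.carrier ξ →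
      e₁ ∈ t.edges ξ := fun a h0 h1 h =>
    hL.edge_of_mem hξ ht (P := A) (Q := i :: B) rfl h0 h1 h.2
  have hE₂ : ∀ a : ℝ, 0 < a → a < 1 → pos ξ A + ξ j + a • ξ i ∈ s.carrier ξ ∩ t.carrier ξ →
      e₂ ∈ t.edges ξ := fun a h0 h1 h => by
    have := hL.edge_of_mem hξ ht (P := A ++ [j]) (c := i) (Q := B) (by simp) h0 h1
      (by rw [hAj]; exact h.2)
    rwa [hAj] at this
  have hboth : e₁ ∈ t.edges ξ → e₂ ∉ t.edges ξ := fun h1 h2 =>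
    hne (Tile.eq_of_right_edges hξ hij h1 h2).symm
  have hmid : ∀ {p q}, p ∈ s.carrier ξ ∩ t.carrier ξ → q ∈ s.carrier ξ ∩ t.carrier ξ →
      (1 / 2 : ℝ) • p + (1 / 2 : ℝ) • q ∈ s.carrier ξ ∩ t.carrier ξ := fun hp hq =>
    hconv hp hq (by norm_num) (by norm_num) (by norm_num)
  by_cases h1 : e₁ ∈ t.edges ξ
  · right
    have hsub : e₁.carrier ξ ⊆ s.carrier ξ ∩ t.carrier ξ := fun p hp =>
      ⟨s.edge_subset hs₁ hp, t.edge_subset h1 hp⟩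
    refine ⟨e₁, hs₁, h1, Set.Subset.antisymm (fun p hp => ?_) hsub⟩
    rcases hright p hp with h | h
    · exact h
    · obtain ⟨a, ha0, ha1, rfl⟩ := (Edge.mem_carrier_iff _ _).1 h
      rcases ha0.eq_or_lt with rfl | ha0
      · simpa [he₁, he₂, Edge.head] using e₁.head_mem_carrier (ξ := ξ)
      · refine absurd (hE₂ (a / 2) (by linarith) (by linarith) ?_) (hboth h1)
        convert hmid hp (hsub e₁.head_mem_carrier) using 1
        simp only [he₁, he₂, Edge.head]
        module
  · by_cases h2 : e₂ ∈ t.edges ξ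
    · right
      have hsub : e₂.carrier ξ ⊆ s.carrier ξ ∩ t.carrier ξ := fun p hp =>
        ⟨s.edge_subset hs₂ hp, t.edge_subset h2 hp⟩
      refine ⟨e₂, hs₂, h2, Set.Subset.antisymm (fun p hp => ?_) hsub⟩
      rcases hright p hp with h | h
      · obtain ⟨a, ha0, ha1, rfl⟩ := (Edge.mem_carrier_iff _ _).1 h
        rcases ha1.eq_or_lt with rfl | ha1
        · simpa using e₂.tail_mem_carrier
        · refine absurd (hE₁ ((a + 1) / 2) (by linarith) (by linarith) ?_) h1
          convert hmid hp (hsub e₂.tail_mem_carrier) using 1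
          simp only [he₁, he₂]
          module
      · exact h
    · left
      have hvert : ∀ p ∈ s.carrier ξ ∩ t.carrier ξ,
          p = pos ξ A ∨ p = pos ξ A + ξ j ∨ p = pos ξ A + ξ j + ξ i := by
        intro p hp
        rcases hright p hp with h | h
        · obtain ⟨a, ha0, ha1, rfl⟩ := (Edge.mem_carrier_iff _ _).1 h
          rcases ha0.eq_or_lt with rfl | ha0
          · simp [he₁]
          · rcases ha1.eq_or_lt with rfl | ha1
            · simp [he₁]
            · exact absurd (hE₁ a ha0 ha1 hp) h1
        · obtain ⟨a, ha0, ha1, rfl⟩ := (Edge.mem_carrier_iff _ _).1 h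
          rcases ha0.eq_or_lt with rfl | ha0
          · simp [he₂]
          · rcases ha1.eq_or_lt with rfl | ha1
            · simp [he₂]
            · exact absurd (hE₂ a ha0 ha1 hp) h2
      have h01 : pos ξ A ∈ s.carrier ξ ∩ t.carrier ξ →
          pos ξ A + ξ j ∉ s.carrier ξ ∩ t.carrier ξ := fun hp hq =>
        h1 (hE₁ (1 / 2) (by norm_num) (by norm_num) (by convert hmid hp hq using 1; module))
      have h12 : pos ξ A + ξ j ∈ s.carrier ξ ∩ t.carrier ξ →
          pos ξ A + ξ j + ξ i ∉ s.carrier ξ ∩ t.carrier ξ := fun hp hq =>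
        h2 (hE₂ (1 / 2) (by norm_num) (by norm_num) (by convert hmid hp hq using 1; module))
      -- The midpoint of the lowest and highest vertices would also be common, hence one of the
      -- three vertices. Heights exclude the two ends, and the middle vertex would force ξᵢ = ξⱼ.
      have h02 : pos ξ A ∈ s.carrier ξ ∩ t.carrier ξ →
          pos ξ A + ξ j + ξ i ∉ s.carrier ξ ∩ t.carrier ξ := by
        intro hp hq
        have hc := hξ.clockwise i j hij
        have hi := hξ.upper i
        have hj := hξ.upper j
        rcases hvert _ (hmid hp hq) with h | h | h
        · have := congrArg (fun v : Plane => v 1) h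
          simp only [PiLp.add_apply, PiLp.smul_apply, smul_eq_mul] at this
          linarith
        · have e0 := congrArg (fun v : Plane => v 0) h
          have e1 := congrArg (fun v : Plane => v 1) h
          simp only [PiLp.add_apply, PiLp.smul_apply, smul_eq_mul] at e0 e1
          have e0' : ξ i 0 = ξ j 0 := by linarith
          have e1' : ξ i 1 = ξ j 1 := by linarith
          rw [e0', e1'] at hc
          linarith
        · have := congrArg (fun v : Plane => v 1) h
          simp only [PiLp.add_apply, PiLp.smul_apply, smul_eq_mul] at this
          linarith
      obtain ⟨p, hp⟩ := hI
      have huniq : ∀ q ∈ s.carrier ξ ∩ t.carrier ξ, q = p := by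
        intro q hq
        rcases hvert p hp with rfl | rfl | rfl <;> rcases hvert q hq with rfl | rfl | rfl <;>
          first | rfl | exact absurd hp (by tauto)
      refine ⟨p, ?_, ?_, Set.eq_singleton_iff_unique_mem.2 ⟨hp, huniq⟩⟩
      · rcases hvert p hp with rfl | rfl | rfl <;> simp [Tile.vertices, hs, add_right_comm]
      · rcases hvert p hp with rfl | rfl | rfl
        · exact hL.vertex_of_mem hξ ht rfl hp.2
        · rw [← hAj] at hp ⊢
          exact hL.vertex_of_mem hξ ht (Q := i :: B) (by simp) hp.2
        · rw [← hAji] at hp ⊢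
          exact hL.vertex_of_mem hξ ht (Q := B) (by simp) hp.2

theorem Sweep.meetProperly (hξ : IsFan ξ) {r l : List (Fin n)} {L : List (Tile n)}
    (h : Sweep ξ r l L) : ∀ s ∈ L, ∀ t ∈ L, s ≠ t → MeetProperly ξ s t := by
  induction h with
  | refl => simp
  | flip A B i j hij L hL ih =>
    intro s hs t ht hne
    rcases List.mem_cons.1 hs with rfl | hs <;> rcases List.mem_cons.1 ht with rfl | ht
    · exact absurd rfl hne
    · exact hL.meetProperly_head hξ hij ht hne
    · exact (hL.meetProperly_head hξ hij hs hne.symm).symm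
    · exact ih s hs t ht hne

/-! ## Edges of a sweep -/

theorem Sweep.edge_left {r l : List (Fin n)} {L : List (Tile n)} (h : Sweep ξ r l L)
    {P Q : List (Fin n)} {c : Fin n} (hl : l = P ++ c :: Q) :
    (∃ t ∈ L, (⟨pos ξ P, c⟩ : Edge n) ∈ t.edges ξ) ∨ HasEdge r P c := by
  induction h generalizing P Q with
  | refl => exact Or.inr ⟨P, Q, List.Perm.refl _, hl⟩
  | flip A B i j hij L hL ih =>
    rcases append_cons_cons_eq_append_cons hl with ⟨A', rfl⟩ | ⟨rfl, rfl⟩ | ⟨rfl, rfl⟩ | ⟨B', rfl, rfl⟩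
    · refine (ih (P := P) (Q := A' ++ j :: i :: B) (by simp)).imp_left ?_
      rintro ⟨t, ht, he⟩
      exact ⟨t, List.mem_cons_of_mem _ ht, he⟩
    · exact Or.inl ⟨_, List.mem_cons_self, by simp [Tile.edges]⟩
    · exact Or.inl ⟨_, List.mem_cons_self, by simp [Tile.edges]⟩
    · have hp := flip_perm A B' i j
      rcases ih (P := A ++ j :: i :: B') (Q := Q) (by simp) with ⟨t, ht, he⟩ | ⟨A₁, B₁, h1, h2⟩
      · rw [pos_perm ξ hp] at he
        exact Or.inl ⟨t, List.mem_cons_of_mem _ ht, he⟩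
      · exact Or.inr ⟨A₁, B₁, h1.trans hp, h2⟩

theorem Sweep.edge_right {r l : List (Fin n)} {L : List (Tile n)} (h : Sweep ξ r l L)
    {P Q : List (Fin n)} {c : Fin n} (hr : r = P ++ c :: Q) :
    (∃ t ∈ L, (⟨pos ξ P, c⟩ : Edge n) ∈ t.edges ξ) ∨ HasEdge l P c := by
  induction h with
  | refl => exact Or.inr ⟨P, Q, List.Perm.refl _, hr⟩
  | flip A B i j hij L hL ih =>
    rcases ih with ⟨t, ht, he⟩ | ⟨P', Q', hP, hl⟩
    · exact Or.inl ⟨t, List.mem_cons_of_mem _ ht, he⟩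
    · rw [← pos_perm ξ hP]
      rcases append_cons_cons_eq_append_cons hl with
        ⟨A', rfl⟩ | ⟨rfl, rfl⟩ | ⟨rfl, rfl⟩ | ⟨B', rfl, rfl⟩
      · exact Or.inr ⟨P', A' ++ i :: j :: B, hP, by simp⟩
      · exact Or.inl ⟨_, List.mem_cons_self, by simp [Tile.edges]⟩
      · exact Or.inl ⟨_, List.mem_cons_self, by simp [Tile.edges]⟩
      · exact Or.inr ⟨A ++ i :: j :: B', Q', (flip_perm A B' j i).trans hP, by simp⟩

/-- A right boundary edge on no tile would also be a left boundary edge with the same colours below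
it. But any second colour is below `c` on one boundary and above it on the other, so n ≥ 2 rules
this out. -/
theorem Sweep.edge_of_hasEdge (hn : 2 ≤ n) {r l : List (Fin n)} {L : List (Tile n)}
    (h : Sweep ξ r l L) (hl : l.Pairwise (· < ·)) (hr : r.Pairwise (· > ·))
    (hlall : ∀ x, x ∈ l) (hrall : ∀ x, x ∈ r) {X : List (Fin n)} {c : Fin n}
    (hX : HasEdge r X c) :
    ∃ t ∈ L, (⟨pos ξ X, c⟩ : Edge n) ∈ t.edges ξ := by
  obtain ⟨A, B, hAX, rfl⟩ := hX
  rw [← pos_perm ξ hAX]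
  refine (h.edge_right rfl).resolve_right ?_
  rintro ⟨A', B', hA, rfl⟩
  have : Nontrivial (Fin n) := Fin.nontrivial_iff_two_le.2 hn
  obtain ⟨d, hd⟩ := exists_ne c
  rw [List.pairwise_append, List.pairwise_cons] at hl hr
  have h1 : d ∉ A := fun hdA =>
    absurd (hr.2.2 d hdA c (by simp)) (hl.2.2 d (hA.mem_iff.2 hdA) c (by simp)).not_gt
  have h2 := hlall d
  have h3 := hrall d
  simp only [List.mem_append, List.mem_cons, hA.mem_iff, h1, hd, false_or] at h2 h3
  exact absurd (hr.2.1.1 d h3) (hl.2.1.1 d h2).not_gt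

/-! ## Covering the zonogon -/

/-- The point lies in the tile of the exchange at which the path first ceases to be strictly to its
left. Strictness at the start is what ensures that such an exchange occurs. -/
theorem Sweep.exists_tile (hξ : IsFan ξ) {r l : List (Fin n)} {L : List (Tile n)}
    (h : Sweep ξ r l L) {p : Plane} (h0 : 0 ≤ p 1) (hl : abscissa ξ l (p 1) < p 0)
    (hr : p 0 ≤ abscissa ξ r (p 1)) : ∃ t ∈ L, p ∈ t.carrier ξ := by
  induction h with
  | refl => exact absurd hr hl.not_ge
  | flip A B i j hij L hL ih =>
    rcases lt_or_ge (abscissa ξ (A ++ j :: i :: B) (p 1)) (p 0) with hlt | hge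
    · obtain ⟨t, ht, hp⟩ := ih hlt
      exact ⟨t, List.mem_cons_of_mem _ ht, hp⟩
    · have hne := (hl.trans_le hge).ne
      refine ⟨_, List.mem_cons_self, (mem_tile_iff A B hξ hij p).2 ⟨?_, ?_, hl.le, hge⟩⟩
      · by_contra h
        exact hne (abscissa_flip_eq A B hξ h0 (Or.inl (not_le.1 h).le))
      · by_contra h
        exact hne (abscissa_flip_eq A B hξ h0 (Or.inr (not_le.1 h).le))

theorem sum_univ_eq_sum_map {M : Type*} [AddCommMonoid M] {l : List (Fin n)} (hl : l.Nodup)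
    (hall : ∀ x, x ∈ l) (f : Fin n → M) : ∑ i, f i = (l.map f).sum := by
  rw [← List.sum_toFinset f hl]
  exact Finset.sum_congr (by ext x; simp [hall]) fun _ _ => rfl

theorem exists_point_at_height (hξ : IsFan ξ) {l : List (Fin n)} (hl : l ≠ []) {y : ℝ} (h0 : 0 ≤ y)
    (h1 : y ≤ pos ξ l 1) : ∃ A c B, ∃ a : ℝ, l = A ++ c :: B ∧ 0 ≤ a ∧ a ≤ 1 ∧
      y = (pos ξ A + a • ξ c) 1 := by
  induction l generalizing y with
  | nil => exact absurd rfl hl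
  | cons c l ih =>
    have hc := hξ.upper c
    simp only [pos_cons, PiLp.add_apply] at h1
    rcases le_or_gt y (ξ c 1) with hy | hy
    · refine ⟨[], c, l, y / ξ c 1, rfl, by positivity, (div_le_one hc).2 hy, ?_⟩
      simp only [pos_nil, PiLp.smul_apply, smul_eq_mul, zero_add]
      field_simp
    · have hne : l ≠ [] := by
        rintro rfl
        simp at h1; linarith
      obtain ⟨A, d, B, a, rfl, ha0, ha1, h⟩ := ih hne (y := y - ξ c 1) (by linarith) (by linarith)
      refine ⟨c :: A, d, B, a, rfl, ha0, ha1, ?_⟩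
      simp only [pos_cons, PiLp.add_apply, PiLp.smul_apply] at h ⊢
      linarith

/-- A linear functional on the unit cube is maximal when the coefficients are 1 on its nonnegative
weights and 0 elsewhere. -/
theorem sum_mul_le {A B : List (Fin n)} {c : Fin n} (hnd : (A ++ c :: B).Nodup)
    (hall : ∀ x, x ∈ A ++ c :: B) {a w : Fin n → ℝ} (ha : ∀ i, 0 ≤ a i ∧ a i ≤ 1)
    (hA : ∀ k ∈ A, 0 ≤ w k) (hc : w c = 0) (hB : ∀ k ∈ B, w k ≤ 0) :
    ∑ i, a i * w i ≤ (A.map w).sum := by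
  rw [sum_univ_eq_sum_map hnd hall]
  have h1 : (A.map fun i => a i * w i).sum ≤ (A.map w).sum :=
    List.sum_le_sum fun k hk => mul_le_of_le_one_left (hA k hk) (ha k).2
  have h2 : (B.map fun i => a i * w i).sum ≤ (B.map fun _ => (0 : ℝ)).sum :=
    List.sum_le_sum fun k hk => mul_nonpos_of_nonneg_of_nonpos (ha k).1 (hB k hk)
  simp only [List.map_const', List.sum_replicate, smul_zero] at h2
  simp only [List.map_append, List.map_cons, List.sum_append, List.sum_cons, hc, mul_zero]
  linarith

/-- Twice the signed area of the triangle `0, u, v`. -/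
def area (u v : Plane) : ℝ := u 0 * v 1 - u 1 * v 0

theorem area_sum (u : Plane) (a : Fin n → ℝ) :
    area u (∑ i, a i • ξ i) = ∑ i, a i * area u (ξ i) := by
  simp only [area, WithLp.ofLp_sum, Finset.sum_apply, PiLp.smul_apply, smul_eq_mul,
    Finset.mul_sum, ← Finset.sum_sub_distrib]
  exact Finset.sum_congr rfl fun i _ => by ring

theorem area_pos (u : Plane) (A : List (Fin n)) :
    area u (pos ξ A) = (A.map fun k => area u (ξ k)).sum := by
  induction A with
  | nil => simp [area]
  | cons c A ih =>
    rw [List.map_cons, List.sum_cons, ← ih]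
    simp only [area, pos_cons, PiLp.add_apply]; ring

theorem zonogon_height (hξ : IsFan ξ) {l : List (Fin n)} (hnd : l.Nodup) (hall : ∀ x, x ∈ l)
    {p : Plane} (hp : p ∈ zonogon ξ) : 0 ≤ p 1 ∧ p 1 ≤ pos ξ l 1 := by
  obtain ⟨a, ha, rfl⟩ := hp
  have h1 : pos ξ l = ∑ i, ξ i := (sum_univ_eq_sum_map hnd hall ξ).symm
  rw [h1]
  simp only [WithLp.ofLp_sum, Finset.sum_apply, PiLp.smul_apply, smul_eq_mul]
  exact ⟨Finset.sum_nonneg fun i _ => mul_nonneg (ha i).1 (hξ.upper i).le,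
    Finset.sum_le_sum fun i _ => mul_le_of_le_one_left (hξ.upper i).le (ha i).2⟩

/-- With `c` the colour of the boundary edge at the height of p, the functional `area (ξ c)` is
nonnegative on the colours before `c` and nonpositive on those after. Its maximum on the zonogon is
thus attained on that edge, and at equal heights it compares horizontal coordinates. -/
theorem abscissa_le_of_mem_zonogon (hξ : IsFan ξ) {l : List (Fin n)} (hl0 : l ≠ [])
    (hl : l.Pairwise (· < ·)) (hall : ∀ x, x ∈ l) {p : Plane} (hp : p ∈ zonogon ξ) :
    abscissa ξ l (p 1) ≤ p 0 := by
  have hnd : l.Nodup := hl.imp fun h => ne_of_lt h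
  obtain ⟨h0, h1⟩ := zonogon_height hξ hnd hall hp
  obtain ⟨A, c, B, t, rfl, ht0, ht1, hy⟩ := exists_point_at_height hξ hl0 h0 h1
  have he := abscissa_edge hξ A c B ht0 ht1
  rw [← hy] at he
  rw [he]
  obtain ⟨a, ha, hpa⟩ := hp
  rw [List.pairwise_append, List.pairwise_cons] at hl
  have hs := sum_mul_le hnd hall ha (w := fun k => area (ξ c) (ξ k))
    (fun k hk => by
      have := hξ.clockwise k c (hl.2.2 k hk c (by simp))
      simp only [area]; linarith)
    (by simp only [area]; ring)
    (fun k hk => (hξ.clockwise c k (hl.2.1.1 k hk)).le)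
  rw [← area_sum, ← hpa, ← area_pos] at hs
  have hc := hξ.upper c
  simp only [area, PiLp.add_apply, PiLp.smul_apply, smul_eq_mul] at hs hy ⊢
  rw [hy] at hs
  refine le_of_mul_le_mul_left ?_ hc
  linarith

theorem le_abscissa_of_mem_zonogon (hξ : IsFan ξ) {r : List (Fin n)} (hr0 : r ≠ [])
    (hr : r.Pairwise (· > ·)) (hall : ∀ x, x ∈ r) {p : Plane} (hp : p ∈ zonogon ξ) :
    p 0 ≤ abscissa ξ r (p 1) := by
  have hnd : r.Nodup := hr.imp fun h => ne_of_gt h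
  obtain ⟨h0, h1⟩ := zonogon_height hξ hnd hall hp
  obtain ⟨A, c, B, t, rfl, ht0, ht1, hy⟩ := exists_point_at_height hξ hr0 h0 h1
  have he := abscissa_edge hξ A c B ht0 ht1
  rw [← hy] at he
  rw [he]
  obtain ⟨a, ha, hpa⟩ := hp
  rw [List.pairwise_append, List.pairwise_cons] at hr
  have hs := sum_mul_le hnd hall ha (w := fun k => -area (ξ c) (ξ k))
    (fun k hk => by
      have := hξ.clockwise c k (hr.2.2 k hk c (by simp))
      simp only [area]; linarith)
    (by simp only [area]; ring)
    (fun k hk => by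
      have := hξ.clockwise k c (hr.2.1.1 k hk)
      simp only [area]; linarith)
  simp only [mul_neg, Finset.sum_neg_distrib] at hs
  have hneg : ∀ A : List (Fin n), (A.map fun k => -area (ξ c) (ξ k)).sum = -area (ξ c) (pos ξ A) := by
    intro A
    rw [area_pos]
    induction A with
    | nil => simp
    | cons d A ih => simp only [List.map_cons, List.sum_cons, ih, neg_add]
  rw [← area_sum, ← hpa, hneg] at hs
  have hc := hξ.upper c
  simp only [area, PiLp.add_apply, PiLp.smul_apply, smul_eq_mul] at hs hy ⊢
  rw [hy] at hs
  refine le_of_mul_le_mul_left ?_ hc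
  linarith

theorem tile_subset_zonogon {A B : List (Fin n)} {i j : Fin n} (hij : i < j)
    (hnd : (A ++ i :: j :: B).Nodup) (hall : ∀ x, x ∈ A ++ i :: j :: B) :
    (⟨pos ξ A, i, j, hij⟩ : Tile n).carrier ξ ⊆ zonogon ξ := by
  rintro _ ⟨a, b, ha, hb, rfl⟩
  classical
  refine ⟨fun k => if k ∈ A then 1 else if k = i then a else if k = j then b else 0,
    fun k => by dsimp only; split_ifs <;> simp [ha, hb], ?_⟩
  rw [sum_univ_eq_sum_map hnd hall]
  simp only [List.nodup_append, List.nodup_cons, List.mem_cons] at hnd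
  have hi : i ∉ A := by grind
  have hj : j ∉ A := by grind
  simp only [List.map_append, List.map_cons, List.sum_append, List.sum_cons, hi, hj, if_false,
    if_true, hij.ne']
  have h1 : (A.map fun k => (if k ∈ A then (1 : ℝ) else if k = i then a else if k = j then b else 0)
      • ξ k) = A.map ξ := List.map_congr_left fun k hk => by simp [hk]
  have h2 : (B.map fun k => (if k ∈ A then (1 : ℝ) else if k = i then a else if k = j then b else 0)
      • ξ k) = B.map fun _ => 0 := List.map_congr_left fun k hk => by
    have : k ∉ A := by grind
    have : k ≠ i := by grind
    have : k ≠ j := by grind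
    simp [*]
  rw [h1, h2]
  simp [pos, add_assoc]

theorem Sweep.tile_subset_zonogon {r l : List (Fin n)} {L : List (Tile n)} (h : Sweep ξ r l L)
    (hnd : l.Nodup) (hall : ∀ x, x ∈ l) {t : Tile n} (ht : t ∈ L) :
    t.carrier ξ ⊆ zonogon ξ := by
  induction h with
  | refl => simp at ht
  | flip A B i j hij L hL ih =>
    have hp := flip_perm A B i j
    rcases List.mem_cons.1 ht with rfl | ht
    · exact Condorcet.tile_subset_zonogon hij hnd hall
    · exact ih (hp.nodup_iff.2 hnd) (fun x => hp.mem_iff.2 (hall x)) ht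

/-! ## Snakes -/

/-- The edges of the upward path from `p` with colours `l`. -/
def pathEdges (ξ : Fin n → Plane) : Plane → List (Fin n) → List (Edge n)
  | _, [] => []
  | p, c :: l => ⟨p, c⟩ :: pathEdges ξ (p + ξ c) l

theorem map_color_pathEdges (p : Plane) (l : List (Fin n)) :
    (pathEdges ξ p l).map Edge.color = l := by
  induction l generalizing p with
  | nil => rfl
  | cons c l ih => simp [pathEdges, ih]

theorem pathEdges_append (p : Plane) (A B : List (Fin n)) :
    pathEdges ξ p (A ++ B) = pathEdges ξ p A ++ pathEdges ξ (p + pos ξ A) B := by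
  induction A generalizing p with
  | nil => simp [pathEdges]
  | cons c A ih => simp [pathEdges, ih, add_assoc]

theorem isChain_pathEdges (p : Plane) (l : List (Fin n)) :
    (pathEdges ξ p l).IsChain (fun e f => e.head ξ = f.tail) := by
  induction l generalizing p with
  | nil => exact List.isChain_nil
  | cons c l ih =>
    cases l with
    | nil => exact List.isChain_singleton _
    | cons d l => exact List.isChain_cons_cons.2 ⟨rfl, ih (p + ξ c)⟩

theorem exists_of_mem_pathEdges {p : Plane} {l : List (Fin n)} {e : Edge n}
    (he : e ∈ pathEdges ξ p l) : ∃ A c B, l = A ++ c :: B ∧ e = ⟨p + pos ξ A, c⟩ := by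
  induction l generalizing p with
  | nil => simp [pathEdges] at he
  | cons c l ih =>
    rcases List.mem_cons.1 he with rfl | he
    · exact ⟨[], c, l, rfl, by simp⟩
    · obtain ⟨A, d, B, rfl, rfl⟩ := ih he
      exact ⟨c :: A, d, B, rfl, by simp [add_assoc]⟩

/-- Edges strictly ascend, and the path already runs from the least to the greatest height
available, so nothing can be attached at either end. -/
theorem isSnake_pathEdges (hξ : IsFan ξ) {T : Finset (Tile n)} {l : List (Fin n)} (hl0 : l ≠ [])
    (hl : ∀ e ∈ pathEdges ξ 0 l, e ∈ edgeSet ξ T)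
    (hT : ∀ e ∈ edgeSet ξ T, 0 ≤ e.tail 1 ∧ (e.head ξ) 1 ≤ pos ξ l 1) :
    IsSnake ξ T (pathEdges ξ 0 l) := by
  refine ⟨⟨hl, isChain_pathEdges 0 l⟩, ?_⟩
  rintro _ ⟨hS, hchain⟩ ⟨P, Q, rfl⟩
  have hP : P = [] := by
    rcases List.eq_nil_or_concat' P with h | ⟨P', e, rfl⟩
    · exact h
    · exfalso
      obtain ⟨c, l', rfl⟩ := List.exists_cons_of_ne_nil hl0
      have hinf : [e, ⟨0, c⟩] <:+: P' ++ [e] ++ pathEdges ξ 0 (c :: l') ++ Q :=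
        ⟨P', pathEdges ξ (0 + ξ c) l' ++ Q, by simp [pathEdges]⟩
      have h1 : e.head ξ = 0 := by simpa using hchain.infix hinf
      have h2 := (hT e (hS e (by simp))).1
      have h3 := congrArg (fun v : Plane => v 1) h1
      have h4 := hξ.upper e.color
      simp only [Edge.head, PiLp.add_apply, PiLp.zero_apply] at h3
      linarith
  have hQ : Q = [] := by
    rcases Q with _ | ⟨e, Q⟩
    · rfl
    · exfalso
      obtain h | ⟨l', c, rfl⟩ := List.eq_nil_or_concat' l
      · exact hl0 h
      have hinf : [⟨0 + pos ξ l', c⟩, e] <:+: P ++ pathEdges ξ 0 (l' ++ [c]) ++ e :: Q :=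
        ⟨P ++ pathEdges ξ 0 l', Q, by rw [pathEdges_append]; simp [pathEdges]⟩
      have h1 : (⟨0 + pos ξ l', c⟩ : Edge n).head ξ = e.tail := by simpa using hchain.infix hinf
      have h2 := (hT e (hS e (by simp))).2
      have h4 := hξ.upper e.color
      simp only [Edge.head, zero_add] at h1
      rw [Edge.head, ← h1] at h2
      simp only [pos_append, pos_cons, pos_nil, PiLp.add_apply, add_zero] at h2
      linarith
  simp [hP, hQ]

/-! ## Initial segments of the orders of a peak-pit domain -/

theorem before_of_word {σ : LinOrd n} {A B : List (Fin n)} (h : word σ = A ++ B) {x y : Fin n}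
    (hx : x ∈ A) (hy : y ∉ A) : Before σ x y := by
  have hmem : ∀ z, z ∈ A ↔ (σ.symm z : ℕ) < A.length := by
    intro z
    have hA : A = (word σ).take A.length := by rw [h]; simp
    rw [hA, word, List.mem_take_iff_getElem]
    have hlen : A.length ≤ n := by
      have := congrArg List.length h
      simp [word] at this
      omega
    constructor
    · rintro ⟨m, hm, rfl⟩
      simp at hm ⊢
      omega
    · intro hz
      refine ⟨σ.symm z, ?_, by simp⟩
      simp at hz ⊢
      omega
  rw [hmem] at hx hy
  exact Fin.lt_def.2 (by omega)

theorem IsPeakPit.not_alternating {D : Set (LinOrd n)} (hD : IsPeakPit D) {σ τ : LinOrd n}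
    (hσ : σ ∈ D) (hτ : τ ∈ D) {i j k : Fin n} (hij : i < j) (hjk : j < k)
    (h1 : Before σ i j) (h2 : Before σ k j) (h3 : Before τ j i) (h4 : Before τ j k) : False := by
  rcases hD i j k hij hjk with h | h
  · have := h τ hτ
    simp only [InPeak, RestrictsTo, Before] at *
    omega
  · have := h σ hσ
    simp only [InPit, RestrictsTo, Before] at *
    omega

/-- Failure of both orientations gives b < a and a' < b' with a, a' in A \ A' and b, b' in A' \ A.
Either a' < b < a or b < a' < b' is then an alternating triple. -/
theorem IsPeakPit.stronglySeparated {D : Set (LinOrd n)} (hD : IsPeakPit D) {σ τ : LinOrd n}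
    (hσ : σ ∈ D) (hτ : τ ∈ D) {A B A' B' : List (Fin n)} (h : word σ = A ++ B)
    (h' : word τ = A' ++ B') : StronglySeparated A.toFinset A'.toFinset := by
  by_contra hns
  simp only [StronglySeparated, Precedes, not_or, List.mem_toFinset] at hns
  push Not at hns
  obtain ⟨⟨a, ha, ha', b, hb, hb', hba⟩, b', hb1, hb1', a', ha1, ha1', hab⟩ := hns
  have hba : b < a := lt_of_le_of_ne hba (by rintro rfl; exact ha' hb)
  have hab : a' < b' := lt_of_le_of_ne hab (by rintro rfl; exact ha1' hb1)
  have hne : a' ≠ b := by rintro rfl; exact ha1' hb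
  rcases lt_or_gt_of_ne hne with hlt | hgt
  · exact hD.not_alternating hσ hτ hlt hba (before_of_word h ha1 hb') (before_of_word h ha hb')
      (before_of_word h' hb ha1') (before_of_word h' hb ha')
  · exact hD.not_alternating hτ hσ hgt hab (before_of_word h' hb ha1') (before_of_word h' hb1 ha1')
      (before_of_word h ha1 hb') (before_of_word h ha1 hb1')

theorem ahead_of_ascending {l : List (Fin n)} (hl : l.Pairwise (· < ·)) (hall : ∀ x, x ∈ l)
    (Y : Finset (Fin n)) : Ahead l Y := by
  rintro A B rfl a ha - b - hb
  have := hall b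
  simp only [List.mem_toFinset] at ha hb
  simp only [List.mem_append, hb, false_or] at this
  exact (List.pairwise_append.1 hl).2.2 a ha b this

end Condorcet

/-! ### Assembling the tiling -/

open Condorcet in
theorem theorem2 (n : ℕ) (hn : 2 ≤ n) (ξ : Fin n → Condorcet.Plane) (hξ : Condorcet.IsFan ξ)
    (D : Set (Condorcet.LinOrd n)) (hD : Condorcet.IsPeakPit D) :
    ∃ T : Finset (Condorcet.Tile n),
      Condorcet.IsRhombusTiling ξ T ∧ D ⊆ Condorcet.tilingDomain ξ T := by
  classical
  let S : Set (Finset (Fin n)) := {X | ∃ σ ∈ D, ∃ A B, word σ = A ++ B ∧ X = A.toFinset}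
  have hS : ∀ X ∈ S, ∀ Y ∈ S, StronglySeparated X Y := by
    rintro _ ⟨σ, hσ, A, B, h, rfl⟩ _ ⟨τ, hτ, A', B', h', rfl⟩
    exact hD.stronglySeparated hσ hτ h h'
  let l : List (Fin n) := List.finRange n
  let r : List (Fin n) := l.reverse
  have hl : l.Pairwise (· < ·) := List.pairwise_lt_finRange n
  have hr : r.Pairwise (· > ·) := List.pairwise_reverse.2 hl
  have hlall : ∀ x, x ∈ l := List.mem_finRange
  have hrall : ∀ x, x ∈ r := fun x => List.mem_reverse.2 (hlall x)
  have hlnd : l.Nodup := List.nodup_finRange n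
  have hlne : l ≠ [] := List.ne_nil_of_mem (hlall ⟨0, by omega⟩)
  have hrne : r ≠ [] := List.ne_nil_of_mem (hrall ⟨0, by omega⟩)
  have hahead : ∀ Y, Ahead l Y := ahead_of_ascending hl hlall
  obtain ⟨L, hL, hcov⟩ := exists_sweep ξ S hS r hr l hlnd hlall l.reverse_perm.symm
    fun Y _ A B hAB => Or.inl (hahead Y A B hAB)
  have hsub : ∀ t ∈ L, t.carrier ξ ⊆ zonogon ξ := fun t ht =>
    hL.tile_subset_zonogon hlnd hlall ht
  refine ⟨L.toFinset, ⟨?_, ?_⟩, ?_⟩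
  · apply Set.Subset.antisymm
    · exact Set.iUnion₂_subset fun t ht => hsub t (List.mem_toFinset.1 ht)
    · intro p hp
      obtain ⟨h0, h1⟩ := zonogon_height hξ hlnd hlall hp
      suffices ∃ t ∈ L, p ∈ t.carrier ξ by simpa using this
      -- Points on the left boundary are not reached by the sweep argument; they are covered because
      -- each boundary edge belongs to a tile.
      rcases (abscissa_le_of_mem_zonogon hξ hlne hl hlall hp).lt_or_eq with hlt | heq
      · exact hL.exists_tile hξ h0 hlt (le_abscissa_of_mem_zonogon hξ hrne hr hrall hp)
      · obtain ⟨A, c, B, a, hAB, ha0, ha1, hy⟩ := exists_point_at_height hξ hlne h0 h1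
        have he := abscissa_edge hξ A c B ha0 ha1
        rw [← hAB, ← hy, heq] at he
        have hpe : p = pos ξ A + a • ξ c := plane_ext he hy
        obtain ⟨t, ht, hte⟩ : ∃ t ∈ L, (⟨pos ξ A, c⟩ : Edge n) ∈ t.edges ξ :=
          (hL.edge_left hAB).elim id (hL.edge_of_hasEdge hn hl hr hlall hrall)
        exact ⟨t, ht, t.edge_subset hte ((Edge.mem_carrier_iff _ _).2 ⟨a, ha0, ha1, hpe⟩)⟩
  · intro s hs t ht hst
    exact hL.meetProperly hξ s (List.mem_toFinset.1 hs) t (List.mem_toFinset.1 ht) hst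
  · intro σ hσ
    have hwnd : (word σ).Nodup := List.nodup_ofFn.2 σ.injective
    have hwall : ∀ x, x ∈ word σ := fun x => by
      rw [word, List.mem_ofFn]; exact σ.surjective x
    refine ⟨pathEdges ξ 0 (word σ), isSnake_pathEdges hξ ?_ ?_ ?_, map_color_pathEdges _ _⟩
    · exact List.ne_nil_of_mem (hwall ⟨0, by omega⟩)
    · intro e he
      obtain ⟨A, c, B, hAB, rfl⟩ := exists_of_mem_pathEdges he
      rw [zero_add]
      rw [hAB] at hwnd
      have hA : A.Nodup := (List.nodup_append.1 hwnd).1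
      have hcA : c ∉ A := fun h => (List.nodup_append.1 hwnd).2.2 c h c (by simp) rfl
      have h1 : A.toFinset ∈ S := ⟨σ, hσ, A, c :: B, hAB, rfl⟩
      have h2 : insert c A.toFinset ∈ S :=
        ⟨σ, hσ, A ++ [c], B, by simpa using hAB, by ext; simp⟩
      obtain ⟨t, ht, hte⟩ := (hcov A c hA hcA h1 h2 (hahead _) (hahead _)).elim id
        (hL.edge_of_hasEdge hn hl hr hlall hrall)
      exact ⟨t, List.mem_toFinset.2 ht, hte⟩
    · rintro e ⟨t, ht, hte⟩
      have hsub' := (t.edge_subset hte).trans (hsub t (List.mem_toFinset.1 ht))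
      exact ⟨(zonogon_height hξ hwnd hwall (hsub' e.tail_mem_carrier)).1,
        (zonogon_height hξ hwnd hwall (hsub' e.head_mem_carrier)).2⟩
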